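/- Let $d,q\ge 0$ be integers, let $V_0,V_1,\dots,V_q:\mathbb{R}^d\to\mathbb{R}$ and $\beta:\mathbb{R}^d\to(0,\infty)$ be twice continuously differentiable, and let $\alpha>0$. Let $$\mathcal{C}=\{\theta\in\mathbb{R}^d : V_j(\theta)\le 0 \text{ for all } j=1,\dots,q\},$$ and let the Robust Safe Gradient Flow (RSGF) be $\dot\theta=\mathcal{R}_{\alpha,\beta}(\theta)$, where $\mathcal{R}_{\alpha,\beta}(\theta)$ is the solution of $$\min_{\xi\in\mathbb{R}^d}\ \tfrac12\|\xi+\nabla V_0(\theta)\|^2\quad\text{s.t.}\quad g_j(\xi,\theta):=\alpha V_j(\theta)+\nabla V_j(\theta)^\top\xi+\tfrac{\beta(\theta)}{2}\|\xi\|^2\le 0,\quad j=1,\dots,q. \tag{P}$$ Assume that for every $\theta\in\mathcal{C}$: * (MFCQ) there is $\xi\in\mathbb{R}^d$ with $\nabla V_j(\theta)^\top\xi<0$ for all $j$ with $V_j(\theta)=0$; * (CRC) with $\xi_\theta=\mathcal{R}_{\alpha,\beta}(\theta)$, there is a neighborhood $\mathcal{N}$ of $(\xi_\theta,\theta)$ such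 that for every set $I\subset\{j : g_j(\xi_\theta,\theta)=0\}$ the rank of $\{\nabla_\xi g_j(\xi,\bar\theta)\}_{j\in I}$ is constant over $(\xi,\bar\theta)\in\mathcal{N}$. Then: 1. (P) is feasible for every $\theta\in\mathcal{C}$. At every $\theta\in\mathbb{R}^d$ where (P) is feasible it has exactly one solution, so that $\mathcal{R}_{\alpha,\beta}(\theta)$ is well defined, and for all $j=1,\dots,q$ $$\nabla V_j(\theta)^\top\mathcal{R}_{\alpha,\beta}(\theta)\le-\alpha V_j(\theta)-\tfrac{\beta(\theta)}{2}\|\mathcal{R}_{\alpha,\beta}(\theta)\|^2 .$$ 2. (Safety) From every $x\in\mathcal{C}$ there is a unique maximal trajectory $\theta(\cdot)$ of the RSGF with $\theta(0)=x$, and $\theta(t)\in\mathcal{C}$ for all $t\ge0$ for which it is defined. It is defined either on $[0,\infty)$ or on $[0,T)$ for some $0<T<\infty$, and in the second case $\|\theta(t)\|\to\infty$ as $t\to T^-$. 3. Consequently, if no trajectory starting in $\mathcal{C}$ escapes to infinity in finite time (that is, every trajectory defined on an interval $[0,T)$ with $T<\infty$ and starting in $\mathcal{C}$ is bounded), in particular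 if $\mathcal{C}$ is bounded, then $\mathcal{C}$ is forward invariant under the RSGF: for every $x\in\mathcal{C}$ the unique trajectory from $x$ is defined for all $t\ge0$ and stays in $\mathcal{C}$ for all $t\ge 0$. -/

import Mathlib

open Set Filter Topology

noncomputable section

namespace RSGF

/-- Euclidean space of dimension `d`. -/
abbrev E (d : ℕ) : Type := EuclideanSpace ℝ (Fin d)

/-! ### Constraint qualifications -/

/-- The feasible set `{x | g j x ≤ 0 for all j}`. -/
def feasibleSet {d q : ℕ} (g : Fin q → E d → ℝ) : Set (E d) :=
  {x | ∀ j, g j x ≤ 0}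

/-- Mangasarian-Fromovitz constraint qualification at `x` for the constraints `g j ≤ 0`. -/
def MFCQAt {d q : ℕ} (g : Fin q → E d → ℝ) (x : E d) : Prop :=
  ∃ ξ : E d, ∀ j, g j x = 0 → inner ℝ (gradient (g j) x) ξ < 0

/-- Constant-rank condition at `(x₀, z₀)` for the constraints `g j x z ≤ 0` of a program in the
variable `x` with parameter `z`: for every set `I` of constraints that are active at `(x₀, z₀)`,
the rank of the partial gradients in `x` of the `g j`, `j ∈ I`, is constant near `(x₀, z₀)`. -/
def ParametricCRCAt {d c q : ℕ} (g : Fin q → E d → E c → ℝ) (x₀ : E d) (z₀ : E c) : Prop :=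
  ∃ N ∈ 𝓝 (x₀, z₀), ∀ I : Set (Fin q), (∀ j ∈ I, g j x₀ z₀ = 0) →
    ∃ r : ℕ, ∀ p ∈ N,
      Set.finrank ℝ ((fun j => gradient (fun x => g j x p.2) p.1) '' I) = r

/-! ### The robust safe gradient flow -/

/-- The `j`-th constraint function
`α V_j(θ) + ∇V_j(θ)ᵀ ξ + (β(θ)/2) ‖ξ‖²`, with variable `ξ` and parameter `θ`. -/
def constraint {d q : ℕ} (V : Fin q → E d → ℝ) (α : ℝ) (β : E d → ℝ)
    (j : Fin q) (ξ θ : E d) : ℝ :=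
  α * V j θ + inner ℝ (gradient (V j) θ) ξ + β θ / 2 * ‖ξ‖ ^ 2

/-- The directions `ξ` that satisfy all the constraints at the parameter `θ`. -/
def feasibleDirections {d q : ℕ} (V : Fin q → E d → ℝ) (α : ℝ) (β : E d → ℝ)
    (θ : E d) : Set (E d) :=
  {ξ | ∀ j, constraint V α β j ξ θ ≤ 0}

/-- `ξ` minimizes `½ ‖ξ + ∇V₀(θ)‖²` over the feasible directions at `θ`. -/
def IsArgmin {d q : ℕ} (V₀ : E d → ℝ) (V : Fin q → E d → ℝ) (α : ℝ) (β : E d → ℝ)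
    (θ ξ : E d) : Prop :=
  ξ ∈ feasibleDirections V α β θ ∧
    ∀ η ∈ feasibleDirections V α β θ,
      1 / 2 * ‖ξ + gradient V₀ θ‖ ^ 2 ≤ 1 / 2 * ‖η + gradient V₀ θ‖ ^ 2

open Classical in
/-- The vector field `R_{α,β}`: the minimizer of `½ ‖ξ + ∇V₀(θ)‖²` over the feasible
directions at `θ` (and the irrelevant value `0` where there is no minimizer). -/
def field {d q : ℕ} (V₀ : E d → ℝ) (V : Fin q → E d → ℝ) (α : ℝ) (β : E d → ℝ)
    (θ : E d) : E d :=
  if h : ∃ ξ, IsArgmin V₀ V α β θ ξ then h.choose else 0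

/-! ### Trajectories and forward invariance -/

/-- `J` is an interval of times whose first element is `0`. -/
def IsTimeInterval (J : Set ℝ) : Prop := J.OrdConnected ∧ IsLeast J 0

/-- `z` solves `ż = F z`, `z 0 = x`, on the time interval `J`
(with one-sided derivatives at the end points that belong to `J`). -/
def IsTrajectory {d : ℕ} (F : E d → E d) (J : Set ℝ) (x : E d) (z : ℝ → E d) : Prop :=
  IsTimeInterval J ∧ z 0 = x ∧ ∀ t ∈ J, HasDerivWithinAt z (F (z t)) J t

/-- `z` on `J` is the unique maximal trajectory of `ż = F z` from `x`: every trajectory from `x`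
is a restriction of it. -/
def IsMaximalTrajectory {d : ℕ} (F : E d → E d) (J : Set ℝ) (x : E d) (z : ℝ → E d) : Prop :=
  IsTrajectory F J x z ∧
    ∀ (J' : Set ℝ) (w : ℝ → E d), IsTrajectory F J' x w → J' ⊆ J ∧ EqOn w z J'

/-- `K` is forward invariant under `ż = F z`: from every `x ∈ K` the (unique) trajectory is
forward complete and remains in `K` for all `t ≥ 0`. -/
def ForwardInvariant {d : ℕ} (F : E d → E d) (K : Set (E d)) : Prop :=
  ∀ x ∈ K, ∃ z : ℝ → E d, IsMaximalTrajectory F (Ici 0) x z ∧ ∀ t, 0 ≤ t → z t ∈ K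

end RSGF

end

/-! The field at `θ` is the metric projection of `-∇V₀(θ)` onto a closed convex set depending on
`θ`. Existence and uniqueness are the projection theorem, and feasibility of the projection is the
key inequality. Along a trajectory it gives `d/dt V_j ≤ -α V_j`, so a nonpositive `V_j` stays
nonpositive (`nonpos_of_deriv_le_neg_mul`, `IsTrajectory.mem_feasibleSet`). MFCQ and `α > 0` provide
a Slater point of the program; this is an open condition in `θ`, so the inequality also holds at
nearby points not yet known to be feasible.

The main work is local Lipschitz continuity of the field (`exists_lipschitzOnWith_field`). Slater's
condition yields continuity and multipliers, and Carathéodory's theorem thins the multipliers to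
independent active gradients. The constant-rank condition carries this independence to the base
point, where it becomes uniform. Hence only finitely many index sets matter, and for a fixed one the
KKT point is Lipschitz in the data (`IsKKT.exists_norm_sub_le`). The pieces may be interleaved
arbitrarily, but a continuous function on a ball that is Lipschitz on each member of a finite cover
is Lipschitz (`lipschitzOnWith_of_finite_cover`).

Picard-Lindelöf and invariance of the closed feasible set then give unique maximal trajectories. The
existence time is uniform near any feasible point, so a finite end time forces the norm to infinity.
-/

namespace RSGF

/-! ### Finitely generated cones -/

section Cones

variable {ι F : Type*} [Fintype ι]

/-- Carathéodory's theorem for cones. -/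
theorem exists_nonneg_linearIndepOn_support [AddCommGroup F] [Module ℝ F] (a : ι → F)
    (l : ι → ℝ) (hl : ∀ i, 0 ≤ l i) :
    ∃ m : ι → ℝ, (∀ i, 0 ≤ m i) ∧ (∀ i, m i ≠ 0 → l i ≠ 0) ∧
      ∑ i, m i • a i = ∑ i, l i • a i ∧ LinearIndepOn ℝ a {i | m i ≠ 0} := by
  classical
  induction hn : (Finset.univ.filter fun i => l i ≠ 0).card using Nat.strong_induction_on
    generalizing l with
  | _ n ih =>
    by_cases hind : LinearIndepOn ℝ a {i | l i ≠ 0}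
    · exact ⟨l, hl, fun _ h => h, rfl, hind⟩
    obtain ⟨c, hcs, hc0, i₀, hi₀⟩ : ∃ c : ι → ℝ, (∀ i, c i ≠ 0 → l i ≠ 0) ∧
        ∑ i, c i • a i = 0 ∧ ∃ i, 0 < c i := by
      have key : ∃ c : ι → ℝ, (∀ i, c i ≠ 0 → l i ≠ 0) ∧ ∑ i, c i • a i = 0 ∧ ∃ i, c i ≠ 0 := by
        rw [LinearIndepOn, Fintype.not_linearIndependent_iff] at hind
        obtain ⟨g, hg, ⟨i, hi⟩, hgi⟩ := hind
        refine ⟨fun i => if h : l i ≠ 0 then g ⟨i, h⟩ else 0, fun i h => ?_, ?_, i, ?_⟩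
        · by_contra h'
          exact h (by simp [h'])
        · rw [← hg]
          refine (Fintype.sum_of_injective (Subtype.val : {i | l i ≠ 0} → ι)
            Subtype.val_injective _ _ (fun i hi => ?_) fun i => ?_).symm
          · have : l i = 0 := by simpa using hi
            simp [this]
          · have : l i ≠ 0 := i.2
            simp [this]
        · have : l i ≠ 0 := hi
          simpa [this] using hgi
      obtain ⟨c, h1, h2, i, hi⟩ := key
      -- Replacing `c` by `-c` if necessary makes some coefficient positive.
      rcases lt_or_gt_of_ne hi with h | h
      · exact ⟨-c, fun i hi => h1 i (by simpa using hi), by simp [h2], i, by simpa using h⟩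
      · exact ⟨c, h1, h2, i, h⟩
    -- Ratio test: `l k / c k` is the largest multiple of `c` that can be subtracted while keeping
    -- all coefficients nonnegative. It kills the `k`-th one, so the support shrinks.
    obtain ⟨k, hk, hmin⟩ := Finset.exists_min_image (Finset.univ.filter fun i => 0 < c i)
      (fun i => l i / c i) ⟨i₀, by simp [hi₀]⟩
    simp only [Finset.mem_filter, Finset.mem_univ, true_and] at hk hmin
    have ht : 0 ≤ l k / c k := div_nonneg (hl k) hk.le
    have hm : ∀ i, 0 ≤ l i - l k / c k * c i := by
      intro i
      rcases le_or_gt (c i) 0 with h | h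
      · nlinarith [hl i]
      · have := (le_div_iff₀ h).1 (hmin i h)
        linarith
    have hms : ∀ i, l i - l k / c k * c i ≠ 0 → l i ≠ 0 := by
      intro i hi h
      have : c i = 0 := by
        by_contra h'
        exact hcs i h' h
      simp [h, this] at hi
    have hmk : l k - l k / c k * c k = 0 := by
      field_simp
      ring
    obtain ⟨m, h1, h2, h3, h4⟩ := ih _ (by
      rw [← hn]
      refine Finset.card_lt_card (Finset.ssubset_iff_of_subset ?_ |>.2 ⟨k, ?_, ?_⟩)
      · intro i
        simpa using hms i
      · simpa using hcs k hk.ne'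
      · simp [hmk]) (fun i => l i - l k / c k * c i) hm rfl
    refine ⟨m, h1, fun i hi => hms i (h2 i hi), ?_, h4⟩
    rw [h3]
    simp only [sub_smul, mul_smul, Finset.sum_sub_distrib, ← Finset.smul_sum, hc0, smul_zero,
      sub_zero]

variable [NormedAddCommGroup F] [InnerProductSpace ℝ F]

/-- Expanding the square and dividing by `t` leaves `2⟪r, v⟫ ≤ t‖v‖²`; then `t` is taken small. This
is the first-order optimality condition behind every minimization below. -/
theorem inner_nonpos_of_forall_norm_le_norm_sub {r v : F}
    (h : ∀ t ∈ Ioc (0 : ℝ) 1, ‖r‖ ≤ ‖r - t • v‖) : inner ℝ r v ≤ 0 := by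
  by_contra! hpos
  have key : ∀ t ∈ Ioc (0 : ℝ) 1, 2 * inner ℝ r v ≤ t * ‖v‖ ^ 2 := by
    intro t ht
    have h1 := pow_le_pow_left₀ (norm_nonneg _) (h t ht) 2
    rw [norm_sub_sq_real, inner_smul_right, norm_smul, mul_pow, Real.norm_eq_abs, sq_abs] at h1
    have h2 : t * (2 * inner ℝ r v) ≤ t * (t * ‖v‖ ^ 2) := by linarith
    exact le_of_mul_le_mul_left h2 ht.1
  set s := inner ℝ r v / (‖v‖ ^ 2 + inner ℝ r v) with hs
  have hd : 0 < ‖v‖ ^ 2 + inner ℝ r v := by positivity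
  have := key s ⟨by positivity, by rw [hs, div_le_one hd]; nlinarith [sq_nonneg ‖v‖]⟩
  have h3 : s * (‖v‖ ^ 2 + inner ℝ r v) = inner ℝ r v := by
    rw [hs]; field_simp
  have h4 : 0 < s := by positivity
  nlinarith

/-- Farkas' lemma for vectors that lie in a common open half space. -/
theorem exists_nonneg_combination_of_forall_inner_nonpos (a : ι → F) (y h₀ : F)
    (hh₀ : ∀ i, inner ℝ (a i) h₀ < 0)
    (hy : ∀ h, (∀ i, inner ℝ (a i) h ≤ 0) → inner ℝ y h ≤ 0) :
    ∃ l : ι → ℝ, (∀ i, 0 ≤ l i) ∧ y = ∑ i, l i • a i := by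
  classical
  obtain ⟨δ, hδ, hδa⟩ : ∃ δ > 0, ∀ i, inner ℝ (a i) h₀ ≤ -δ := by
    rcases isEmpty_or_nonempty ι with h | h
    · exact ⟨1, one_pos, fun i => (IsEmpty.false i).elim⟩
    · obtain ⟨k, hk⟩ := Finite.exists_max fun i => inner ℝ (a i) h₀
      exact ⟨-inner ℝ (a k) h₀, by simpa using hh₀ k, fun i => by simpa using hk i⟩
  set f : (ι → ℝ) → F := fun l => y - ∑ i, l i • a i with hf
  have hfc : Continuous f := by fun_prop
  set M := 2 * ‖y‖ * ‖h₀‖ / δ with hM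
  have hM0 : 0 ≤ M := by positivity
  -- The half space makes the minimization of `‖f l‖` coercive: pairing with `h₀` bounds `δ ∑ l i`
  -- by the norm of the combination times `‖h₀‖`, and only combinations of norm at most `2‖y‖`
  -- compete with `l = 0`.
  have hbound : ∀ l : ι → ℝ, (∀ i, 0 ≤ l i) → ‖f l‖ ≤ ‖y‖ → ∀ i, l i ≤ M := by
    intro l hl hle i
    have h1 : inner ℝ (∑ i, l i • a i) h₀ ≤ -(δ * ∑ i, l i) := by
      rw [sum_inner, Finset.mul_sum, ← Finset.sum_neg_distrib]
      refine Finset.sum_le_sum fun i _ => ?_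
      rw [real_inner_smul_left]
      nlinarith [hl i, hδa i]
    have h2 : ‖∑ i, l i • a i‖ ≤ 2 * ‖y‖ := by
      have : ∑ i, l i • a i = y - f l := by simp [hf]
      rw [this]
      linarith [norm_sub_le y (f l)]
    have h3 := (abs_le.1 (abs_real_inner_le_norm (∑ i, l i • a i) h₀)).1
    have h4 : ‖∑ i, l i • a i‖ * ‖h₀‖ ≤ 2 * ‖y‖ * ‖h₀‖ := by gcongr
    have h5 := Finset.single_le_sum (fun i _ => hl i) (Finset.mem_univ i)
    rw [hM, le_div_iff₀ hδ]
    nlinarith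
  obtain ⟨l, hlK, hlmin⟩ := (isCompact_Icc (a := (0 : ι → ℝ)) (b := fun _ => M)).exists_isMinOn
    ⟨0, le_rfl, fun _ => hM0⟩ hfc.norm.continuousOn
  have hl : ∀ i, 0 ≤ l i := fun i => hlK.1 i
  have hmin : ∀ m : ι → ℝ, (∀ i, 0 ≤ m i) → ‖f l‖ ≤ ‖f m‖ := by
    intro m hm
    have h0 : ‖f l‖ ≤ ‖y‖ := by
      have := hlmin (show (0 : ι → ℝ) ∈ Icc 0 (fun _ => M) from ⟨le_rfl, fun _ => hM0⟩)
      simpa [hf] using this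
    rcases le_total ‖f m‖ ‖y‖ with h | h
    · exact hlmin ⟨hm, hbound m hm h⟩
    · exact h0.trans h
  -- Increasing one coefficient does not improve the minimum, so the residual `f l` is an admissible
  -- direction in `hy`.
  have hra : ∀ i, inner ℝ (a i) (f l) ≤ 0 := by
    intro i
    rw [real_inner_comm]
    refine inner_nonpos_of_forall_norm_le_norm_sub fun t ht => ?_
    convert hmin (l + Pi.single i t) (fun k => ?_) using 2
    · simp only [hf, Pi.add_apply, add_smul, Finset.sum_add_distrib, sub_sub]
      congr 2
      rw [Finset.sum_eq_single i] <;> simp +contextual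
    · have : (0 : ι → ℝ) ≤ Pi.single i t := Pi.single_nonneg.2 ht.1.le
      exact add_nonneg (hl k) (this k)
  -- Shrinking all coefficients does not improve it either; with `hy` this forces `‖f l‖² ≤ 0`.
  have hrp : inner ℝ (f l) (-∑ i, l i • a i) ≤ 0 := by
    refine inner_nonpos_of_forall_norm_le_norm_sub fun t ht => ?_
    convert hmin ((1 - t) • l) (fun k => ?_) using 2
    · simp only [hf, Pi.smul_apply, smul_eq_mul, mul_smul, ← Finset.smul_sum]
      module
    · exact mul_nonneg (by linarith [ht.2]) (hl k)
  have h1 := hy (f l) hra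
  have h2 : y = f l + ∑ i, l i • a i := by simp [hf]
  have h3 : f l = 0 := by
    have h4 : inner ℝ y (f l) = ‖f l‖ ^ 2 + inner ℝ (f l) (∑ i, l i • a i) := by
      nth_rw 1 [h2]
      rw [inner_add_left, real_inner_self_eq_norm_sq, real_inner_comm]
    rw [inner_neg_right] at hrp
    have : ‖f l‖ ^ 2 ≤ 0 := by linarith
    simpa using this
  exact ⟨l, hl, sub_eq_zero.1 h3⟩

/-- A linearly independent finite family stays uniformly linearly independent under small
perturbations. -/
theorem exists_forall_mul_sum_abs_le_norm_sum [FiniteDimensional ℝ F] {a : ι → F} (s : Finset ι)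
    (h : LinearIndepOn ℝ a (s : Set ι)) :
    ∃ σ > 0, ∀ b : ι → F, (∀ i ∈ s, ‖b i - a i‖ ≤ σ) →
      ∀ c : ι → ℝ, σ * ∑ i ∈ s, |c i| ≤ ‖∑ i ∈ s, c i • b i‖ := by
  classical
  set T : (s → ℝ) →ₗ[ℝ] F := Fintype.linearCombination ℝ (fun i : s => a i) with hT
  have hker : LinearMap.ker T = ⊥ :=
    LinearMap.ker_eq_bot.2 (linearIndependent_iff_injective_fintypeLinearCombination.1 h)
  obtain ⟨K, hK, hTK⟩ := T.exists_antilipschitzWith hker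
  have hK' : (0 : ℝ) < K := hK
  -- The factor 2 leaves room to absorb the perturbation: the unperturbed family satisfies the bound
  -- with `2 * σ`. The `+ 1` covers empty `s`.
  set σ : ℝ := 1 / (2 * K * (s.card + 1)) with hσ
  have hσ0 : 0 < σ := by positivity
  refine ⟨σ, hσ0, fun b hb c => ?_⟩
  have h1 : ‖fun i : s => c i‖ ≤ K * ‖∑ i ∈ s, c i • a i‖ := by
    have := hTK.le_mul_dist (fun i : s => c i) 0
    rw [dist_zero_right, map_zero, dist_zero_right, hT, Fintype.linearCombination_apply] at this
    rwa [Finset.sum_coe_sort s (fun i => c i • a i)] at this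
  have h2 : ∑ i ∈ s, |c i| ≤ s.card * (K * ‖∑ i ∈ s, c i • a i‖) := by
    rw [← nsmul_eq_mul]
    refine Finset.sum_le_card_nsmul _ _ _ fun i hi => ?_
    exact (norm_le_pi_norm (fun i : s => c i) ⟨i, hi⟩).trans h1
  have h3 : ‖∑ i ∈ s, c i • a i‖ ≤ ‖∑ i ∈ s, c i • b i‖ + σ * ∑ i ∈ s, |c i| := by
    have : ∑ i ∈ s, c i • a i = ∑ i ∈ s, c i • b i - ∑ i ∈ s, c i • (b i - a i) := by
      simp [smul_sub]
    rw [this]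
    refine (norm_sub_le _ _).trans (add_le_add_right ?_ _)
    rw [Finset.mul_sum]
    refine norm_sum_le_of_le _ fun i hi => ?_
    rw [norm_smul, Real.norm_eq_abs, mul_comm]
    gcongr
    exact hb i hi
  have h4 : 2 * σ * ∑ i ∈ s, |c i| ≤ ‖∑ i ∈ s, c i • a i‖ := by
    have h5 : ∑ i ∈ s, |c i| ≤ (s.card + 1) * (K * ‖∑ i ∈ s, c i • a i‖) :=
      h2.trans (by gcongr; linarith)
    have h6 : 2 * σ * ((s.card + 1) * (K * ‖∑ i ∈ s, c i • a i‖)) = ‖∑ i ∈ s, c i • a i‖ := by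
      rw [hσ]; field_simp
    rw [← h6]
    gcongr
  linarith

end Cones

/-! ### Gluing Lipschitz bounds -/

/-- Continuous induction: the times at which the bound from `a` holds form a closed set that can
always be prolonged to the right. -/
theorem norm_sub_le_of_forall_eventually {F : Type*} [NormedAddCommGroup F] {f : ℝ → F}
    {K a b : ℝ} (hf : ContinuousOn f (Icc a b)) (hab : a ≤ b)
    (h : ∀ t ∈ Ico a b, ∀ᶠ s in 𝓝[>] t, ‖f s - f t‖ ≤ K * (s - t)) :
    ‖f b - f a‖ ≤ K * (b - a) := by
  have key : Icc a b ⊆ {t | ‖f t - f a‖ ≤ K * (t - a)} := by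
    refine IsClosed.Icc_subset_of_forall_exists_gt ?_ (by simp) ?_
    · rw [inter_comm]
      have h1 : ContinuousOn (fun t => ‖f t - f a‖ - K * (t - a)) (Icc a b) := by fun_prop
      convert h1.preimage_isClosed_of_isClosed isClosed_Icc (isClosed_Iic (a := (0 : ℝ))) using 2
      ext t
      simp
    · rintro x ⟨hx, hxab⟩ y hy
      have h1 : ∀ᶠ s in 𝓝[>] x, s ∈ Ioc x y := Ioc_mem_nhdsGT hy
      obtain ⟨s, hs, hsy⟩ := ((h x hxab).and h1).exists
      refine ⟨s, ?_, hsy⟩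
      have h2 : ‖f x - f a‖ ≤ K * (x - a) := hx
      have h3 : f s - f a = (f s - f x) + (f x - f a) := by abel
      simp only [mem_ofPred_eq, h3]
      refine (norm_add_le _ _).trans ?_
      linarith
  exact key (right_mem_Icc.2 hab)

/-- A continuous function on a convex set that is `K`-Lipschitz on each of the finitely many
members of a cover is `K`-Lipschitz. -/
theorem lipschitzOnWith_of_finite_cover {ι F G : Type*} [Finite ι] [NormedAddCommGroup F]
    [NormedSpace ℝ F] [NormedAddCommGroup G] {f : F → G} {U : Set F} {K : NNReal}
    (hU : Convex ℝ U) (hf : ContinuousOn f U) (A : ι → Set F) (hcov : U ⊆ ⋃ i, A i)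
    (hA : ∀ i, LipschitzOnWith K f (A i ∩ U)) : LipschitzOnWith K f U := by
  refine LipschitzOnWith.of_dist_le_mul fun y hy x hx => ?_
  set γ : ℝ → F := fun t => x + t • (y - x) with hγ
  have hγc : Continuous γ := by fun_prop
  have hγU : MapsTo γ (Icc 0 1) U := fun t ht => hU.add_smul_sub_mem hx hy ht
  have hfγ : ContinuousOn (f ∘ γ) (Icc 0 1) := hf.comp hγc.continuousOn hγU
  have hγd : ∀ s t, dist (γ s) (γ t) = |s - t| * ‖y - x‖ := by
    intro s t
    rw [dist_eq_norm, hγ]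
    simp only [add_sub_add_left_eq_sub, ← sub_smul, norm_smul, Real.norm_eq_abs]
  have key := norm_sub_le_of_forall_eventually (K := K * ‖y - x‖) hfγ zero_le_one ?_
  · simpa [hγ, dist_eq_norm] using key
  intro t ht
  have hev : ∀ i, ∀ᶠ s in 𝓝[>] t, γ s ∈ A i → ‖f (γ s) - f (γ t)‖ ≤ K * ‖y - x‖ * (s - t) := by
    intro i
    have hnear : ∀ᶠ s in 𝓝[>] t, s ∈ Ioc t 1 := Ioc_mem_nhdsGT ht.2
    -- If the segment meets `A i` at times decreasing to `t`, continuity carries the Lipschitz bound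
    -- to `γ t`, which need not lie in `A i`. Otherwise `A i` is avoided just after `t` and the
    -- claim is vacuous.
    by_cases hfr : ∃ᶠ s in 𝓝[>] t, γ s ∈ A i
    · have hle : 𝓝[>] t ≤ 𝓝[Icc 0 1] t := by
        refine nhdsWithin_le_iff.2 ?_
        filter_upwards [hnear] with s hs using ⟨ht.1.trans hs.1.le, hs.2⟩
      have hlim : Tendsto (fun r => f (γ r)) (𝓝[>] t) (𝓝 (f (γ t))) :=
        (hfγ t ⟨ht.1, ht.2.le⟩).mono_left hle
      filter_upwards [hnear] with s hs hsA
      have hlimr : Tendsto (fun r : ℝ => K * ‖y - x‖ * |s - r|) (𝓝[>] t)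
          (𝓝 (K * ‖y - x‖ * |s - t|)) :=
        (Continuous.tendsto (by fun_prop) t).mono_left nhdsWithin_le_nhds
      rw [← abs_of_pos (sub_pos.2 hs.1)]
      refine le_of_tendsto_of_tendsto_of_frequently (tendsto_const_nhds.sub hlim).norm hlimr ?_
      refine (hfr.and_eventually hnear).mono fun r hr => ?_
      rw [← dist_eq_norm]
      refine ((hA i).dist_le_mul _ ⟨hsA, hγU ⟨ht.1.trans hs.1.le, hs.2⟩⟩ _
        ⟨hr.1, hγU ⟨ht.1.trans hr.2.1.le, hr.2.2⟩⟩).trans_eq ?_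
      rw [hγd]
      ring
    · filter_upwards [not_frequently.1 hfr] with s hs hsA
      exact absurd hsA hs
  have hnear : ∀ᶠ s in 𝓝[>] t, s ∈ Ioc t 1 := Ioc_mem_nhdsGT ht.2
  filter_upwards [eventually_all.2 hev, hnear] with s hs hst
  obtain ⟨i, hi⟩ := mem_iUnion.1 (hcov (hγU ⟨ht.1.trans hst.1.le, hst.2⟩))
  exact hs i hi

/-! ### Stability of Karush-Kuhn-Tucker points -/

section KKT

variable {ι F : Type*} [NormedAddCommGroup F] [InnerProductSpace ℝ F]

/-- `ξ` is a Karush-Kuhn-Tucker point for the projection of `y` onto the set given by the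
constraints `p j + ⟨v j, ξ⟩ + b / 2 * ‖ξ‖ ^ 2 ≤ 0`, with multipliers `l` supported on the set `s` of
active constraints, whose gradients satisfy a quantitative independence estimate. -/
structure IsKKT (s : Finset ι) (σ M : ℝ) (p : ι → ℝ) (v : ι → F) (b : ℝ) (y ξ : F)
    (l : ι → ℝ) : Prop where
  active : ∀ j ∈ s, p j + inner ℝ (v j) ξ + b / 2 * ‖ξ‖ ^ 2 = 0
  stationary : ξ + ∑ j ∈ s, l j • (v j + b • ξ) = y
  nonneg : ∀ j, 0 ≤ l j
  independent : ∀ c : ι → ℝ, σ * ∑ j ∈ s, |c j| ≤ ‖∑ j ∈ s, c j • (v j + b • ξ)‖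
  b_nonneg : 0 ≤ b
  b_le : b ≤ M
  norm_y_le : ‖y‖ ≤ M
  norm_le : ‖ξ‖ ≤ M

theorem IsKKT.sum_le {s : Finset ι} {σ M : ℝ} {p : ι → ℝ} {v : ι → F} {b : ℝ} {y ξ : F}
    {l : ι → ℝ} (h : IsKKT s σ M p v b y ξ l) (hσ : 0 < σ) : ∑ j ∈ s, l j ≤ 2 * M / σ := by
  rw [le_div_iff₀ hσ, mul_comm]
  have h1 := h.independent l
  simp only [abs_of_nonneg (h.nonneg _)] at h1
  have h2 : ∑ j ∈ s, l j • (v j + b • ξ) = y - ξ := by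
    rw [← h.stationary]; abel
  rw [h2] at h1
  linarith [norm_sub_le y ξ, h.norm_y_le, h.norm_le]

/-- Two Karush-Kuhn-Tucker points with the same active index set depend in a Lipschitz way on the
data. -/
theorem IsKKT.exists_norm_sub_le (s : Finset ι) {σ M L : ℝ} (hσ : 0 < σ) (hM : 0 ≤ M)
    (hL : 0 ≤ L) :
    ∃ K : ℝ, 0 ≤ K ∧ ∀ (p p' : ι → ℝ) (v v' : ι → F) (b b' : ℝ) (y y' ξ ξ' : F) (l l' : ι → ℝ)
      (δ : ℝ), IsKKT s σ M p v b y ξ l → IsKKT s σ M p' v' b' y' ξ' l' →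
      0 ≤ δ → (∀ j, |p' j - p j| ≤ L * δ) → (∀ j, ‖v' j - v j‖ ≤ L * δ) → |b' - b| ≤ L * δ →
      ‖y' - y‖ ≤ L * δ → ‖ξ' - ξ‖ ≤ K * δ := by
  -- `A * δ` bounds the change of a constraint, `S` the sum of the multipliers, and `c₁`, `c₂` are
  -- the coefficients in the final estimate `D² ≤ c₁ δ D + c₂ δ²`.
  set A := L * (1 + M + M ^ 2 / 2) with hA
  set S := 2 * M / σ with hS
  set c₁ := L + S * (L * (1 + M)) + (1 + S * M) / σ * A with hc₁
  set c₂ := (L + S * (L * (1 + M))) / σ * A with hc₂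
  have hS0 : 0 ≤ S := by positivity
  have hA0 : 0 ≤ A := by positivity
  have hc₁0 : 0 ≤ c₁ := by positivity
  have hc₂0 : 0 ≤ c₂ := by positivity
  refine ⟨c₁ + c₂ + 1, by positivity, ?_⟩
  intro p p' v v' b b' y y' ξ ξ' l l' δ h h' hδ hp hv hb hy
  set D := ‖ξ' - ξ‖ with hD
  have hD0 : 0 ≤ D := norm_nonneg _
  have hLδ : 0 ≤ L * δ := by positivity
  -- The change of the `j`-th constraint at the fixed point `η` when the data pass from unprimed to
  -- primed.
  set Δ : ι → F → ℝ := fun j η =>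
    (p' j - p j) + inner ℝ (v' j - v j) η + (b' - b) / 2 * ‖η‖ ^ 2 with hΔ
  have hΔ1 : ∀ j, |Δ j ξ| ≤ A * δ := by
    intro j
    have h1 : |inner ℝ (v' j - v j) ξ| ≤ L * δ * M :=
      (abs_real_inner_le_norm _ _).trans
        (mul_le_mul (hv j) h.norm_le (norm_nonneg _) hLδ)
    have h2 : |(b' - b) / 2 * ‖ξ‖ ^ 2| ≤ L * δ / 2 * M ^ 2 := by
      rw [abs_mul, abs_div, abs_two, abs_of_nonneg (sq_nonneg ‖ξ‖)]
      gcongr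
      exact h.norm_le
    have h3 : |Δ j ξ| ≤ L * δ + L * δ * M + L * δ / 2 * M ^ 2 :=
      (abs_add_three _ _ _).trans (add_le_add (add_le_add (hp j) h1) h2)
    rw [hA]
    linarith
  have hΔ2 : ∀ j, |Δ j ξ - Δ j ξ'| ≤ L * (1 + M) * δ * D := by
    intro j
    have h0 : Δ j ξ - Δ j ξ' = -inner ℝ (v' j - v j) (ξ' - ξ) +
        (b' - b) / 2 * (‖ξ‖ ^ 2 - ‖ξ'‖ ^ 2) := by
      simp only [hΔ, inner_sub_right]
      ring
    have h1 : |-inner ℝ (v' j - v j) (ξ' - ξ)| ≤ L * δ * D := by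
      rw [abs_neg]
      exact (abs_real_inner_le_norm _ _).trans
        (mul_le_mul_of_nonneg_right (hv j) (norm_nonneg _))
    have h2 : |(b' - b) / 2 * (‖ξ‖ ^ 2 - ‖ξ'‖ ^ 2)| ≤ L * δ / 2 * (2 * M * D) := by
      rw [abs_mul, abs_div, abs_two]
      gcongr
      rw [sq_sub_sq, abs_mul]
      have h4 : |‖ξ‖ + ‖ξ'‖| ≤ 2 * M := by
        rw [abs_of_nonneg (by positivity)]
        linarith [h.norm_le, h'.norm_le]
      have h5 : |‖ξ‖ - ‖ξ'‖| ≤ D := by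
        rw [hD, norm_sub_rev]
        exact abs_norm_sub_norm_le _ _
      gcongr
    rw [h0]
    refine (abs_add_le _ _).trans ((add_le_add h1 h2).trans_eq ?_)
    ring
  have hl : ∑ j ∈ s, l j ≤ S := h.sum_le hσ
  have hl' : ∑ j ∈ s, l' j ≤ S := h'.sum_le hσ
  have ha : ∀ j, ‖(v' j + b' • ξ') - (v j + b • ξ)‖ ≤ L * (1 + M) * δ + M * D := by
    intro j
    have h0 : (v' j + b' • ξ') - (v j + b • ξ) =
        (v' j - v j) + (b' - b) • ξ + b' • (ξ' - ξ) := by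
      module
    rw [h0]
    refine (norm_add₃_le).trans ?_
    rw [norm_smul, norm_smul, Real.norm_eq_abs, Real.norm_eq_abs, abs_of_nonneg h'.b_nonneg]
    have h1 : |b' - b| * ‖ξ‖ ≤ L * δ * M := mul_le_mul hb h.norm_le (norm_nonneg _) hLδ
    have h2 : b' * ‖ξ' - ξ‖ ≤ M * D := mul_le_mul_of_nonneg_right h'.b_le hD0
    linarith [hv j]
  -- The multipliers differ by `O(δ + D)`: subtract the stationarity equations and apply the
  -- quantitative independence.
  have hll : ∑ j ∈ s, |l' j - l j| ≤
      (L * δ + D + S * (L * (1 + M) * δ + M * D)) / σ := by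
    rw [le_div_iff₀ hσ, mul_comm]
    refine (h.independent fun j => l' j - l j).trans ?_
    have h0 : ∑ j ∈ s, (l' j - l j) • (v j + b • ξ) = (y' - y) - (ξ' - ξ) -
        ∑ j ∈ s, l' j • ((v' j + b' • ξ') - (v j + b • ξ)) := by
      rw [← h.stationary, ← h'.stationary]
      simp only [sub_smul, smul_sub, Finset.sum_sub_distrib]
      abel
    rw [h0]
    refine (norm_sub_le _ _).trans (add_le_add ((norm_sub_le _ _).trans ?_) ?_)
    · linarith
    · refine (norm_sum_le_of_le (f := fun j => l' j • ((v' j + b' • ξ') - (v j + b • ξ))) s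
        (n := fun j => l' j * (L * (1 + M) * δ + M * D)) fun j _ => ?_).trans ?_
      · rw [norm_smul, Real.norm_eq_abs, abs_of_nonneg (h'.nonneg j)]
        exact mul_le_mul_of_nonneg_left (ha j) (h'.nonneg j)
      · rw [← Finset.sum_mul]
        gcongr
  -- Pair the difference of the stationarity equations with `ξ' - ξ`. The active equalities turn
  -- each gradient term into a curvature term in `D²` of favourable sign and a data change `Δ`.
  have hmain : D ^ 2 ≤ L * δ * D + ∑ j ∈ s, (l' j * Δ j ξ - l j * Δ j ξ') := by
    have h1 : inner ℝ (ξ' - ξ) (ξ' - ξ) + ∑ j ∈ s, (l' j * inner ℝ (v' j + b' • ξ') (ξ' - ξ) -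
        l j * inner ℝ (v j + b • ξ) (ξ' - ξ)) = inner ℝ (y' - y) (ξ' - ξ) := by
      rw [← h.stationary, ← h'.stationary]
      simp only [inner_add_left, inner_sub_left, sum_inner, real_inner_smul_left,
        Finset.sum_sub_distrib]
      ring
    rw [real_inner_self_eq_norm_sq] at h1
    have h2 : inner ℝ (y' - y) (ξ' - ξ) ≤ L * δ * D :=
      (real_inner_le_norm _ _).trans (mul_le_mul_of_nonneg_right hy hD0)
    have h3 : ∑ j ∈ s, -(l' j * Δ j ξ - l j * Δ j ξ') ≤
        ∑ j ∈ s, (l' j * inner ℝ (v' j + b' • ξ') (ξ' - ξ) -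
          l j * inner ℝ (v j + b • ξ) (ξ' - ξ)) := by
      refine Finset.sum_le_sum fun j hj => ?_
      have hsq : D ^ 2 = ‖ξ'‖ ^ 2 - 2 * inner ℝ ξ' ξ + ‖ξ‖ ^ 2 := by
        rw [hD, norm_sub_sq_real]
      have e1 : inner ℝ (v' j + b' • ξ') (ξ' - ξ) = b' / 2 * D ^ 2 - Δ j ξ := by
        have i1 := h.active j hj
        have i2 := h'.active j hj
        simp only [hΔ, inner_add_left, inner_sub_left, inner_sub_right, real_inner_smul_left,
          real_inner_self_eq_norm_sq, hsq]
        linarith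
      have e2 : inner ℝ (v j + b • ξ) (ξ' - ξ) = -Δ j ξ' - b / 2 * D ^ 2 := by
        have i1 := h.active j hj
        have i2 := h'.active j hj
        simp only [hΔ, inner_add_left, inner_sub_left, inner_sub_right, real_inner_smul_left,
          real_inner_self_eq_norm_sq, hsq, real_inner_comm ξ' ξ]
        linarith
      rw [e1, e2]
      have k1 : 0 ≤ l' j * (b' / 2 * D ^ 2) :=
        mul_nonneg (h'.nonneg j) (mul_nonneg (by linarith [h'.b_nonneg]) (sq_nonneg D))
      have k2 : 0 ≤ l j * (b / 2 * D ^ 2) :=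
        mul_nonneg (h.nonneg j) (mul_nonneg (by linarith [h.b_nonneg]) (sq_nonneg D))
      linarith
    rw [Finset.sum_neg_distrib] at h3
    linarith
  -- Bounding the two terms separately gives only `O(δ)`, hence `D = O(√δ)`. Regrouping by
  -- differences of `l` and of `Δ` gains a factor `δ + D`.
  have hsum : ∑ j ∈ s, (l' j * Δ j ξ - l j * Δ j ξ') ≤
      (∑ j ∈ s, |l' j - l j|) * (A * δ) + (∑ j ∈ s, l j) * (L * (1 + M) * δ * D) := by
    rw [Finset.sum_mul, Finset.sum_mul, ← Finset.sum_add_distrib]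
    refine Finset.sum_le_sum fun j _ => ?_
    have e : l' j * Δ j ξ - l j * Δ j ξ' =
        (l' j - l j) * Δ j ξ + l j * (Δ j ξ - Δ j ξ') := by ring
    rw [e]
    refine add_le_add ?_ (mul_le_mul_of_nonneg_left ((le_abs_self _).trans (hΔ2 j)) (h.nonneg j))
    refine (le_abs_self _).trans ?_
    rw [abs_mul]
    exact mul_le_mul_of_nonneg_left (hΔ1 j) (abs_nonneg _)
  have hquad : D ^ 2 ≤ c₁ * δ * D + c₂ * δ ^ 2 := by
    have h1 : (∑ j ∈ s, |l' j - l j|) * (A * δ) ≤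
        (L * δ + D + S * (L * (1 + M) * δ + M * D)) / σ * (A * δ) := by gcongr
    have h2 : (∑ j ∈ s, l j) * (L * (1 + M) * δ * D) ≤ S * (L * (1 + M) * δ * D) := by gcongr
    have h3 : L * δ * D + ((L * δ + D + S * (L * (1 + M) * δ + M * D)) / σ * (A * δ) +
        S * (L * (1 + M) * δ * D)) = c₁ * δ * D + c₂ * δ ^ 2 := by
      rw [hc₁, hc₂]
      ring
    linarith
  by_contra! hlt
  have h1 : δ ≤ D := by nlinarith [mul_nonneg hc₁0 hδ, mul_nonneg hc₂0 hδ]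
  have hDpos : 0 < D := lt_of_le_of_lt (by positivity) hlt
  have h2 : (c₁ + c₂ + 1) * δ * D < D * D := mul_lt_mul_of_pos_right hlt hDpos
  have h3 : c₂ * δ * δ ≤ c₂ * δ * D := by gcongr
  have h4 : 0 ≤ δ * D := by positivity
  nlinarith

end KKT

/-! ### Differential inequalities and local existence -/

/-- The integrating factor `exp (c t)` makes `exp (c t) * u t` nonincreasing. -/
theorem nonpos_of_deriv_le_neg_mul {u u' : ℝ → ℝ} {c a b : ℝ} (hu : ContinuousOn u (Icc a b))
    (hu' : ∀ t ∈ Ioo a b, HasDerivAt u (u' t) t) (hle : ∀ t ∈ Ioo a b, u' t ≤ -c * u t)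
    (ha : u a ≤ 0) : ∀ t ∈ Icc a b, u t ≤ 0 := by
  intro t ht
  have hanti : AntitoneOn (fun t => Real.exp (c * t) * u t) (Icc a b) := by
    refine antitoneOn_of_hasDerivWithinAt_nonpos (convex_Icc a b)
      (f' := fun t => Real.exp (c * t) * (c * 1) * u t + Real.exp (c * t) * u' t)
      (ContinuousOn.mul (by fun_prop) hu) ?_ ?_
    · intro s hs
      rw [interior_Icc] at hs
      exact ((((hasDerivAt_id s).const_mul c).exp).mul (hu' s hs)).hasDerivWithinAt
    · intro s hs
      rw [interior_Icc] at hs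
      have h1 : Real.exp (c * s) * u' s ≤ Real.exp (c * s) * (-c * u s) :=
        mul_le_mul_of_nonneg_left (hle s hs) (Real.exp_pos _).le
      linarith
  have h1 := hanti (left_mem_Icc.2 (ht.1.trans ht.2)) ht ht.1
  have h2 : Real.exp (c * a) * u a ≤ 0 := mul_nonpos_of_nonneg_of_nonpos (Real.exp_pos _).le ha
  have h3 : Real.exp (c * t) * u t ≤ 0 := h1.trans h2
  by_contra! hpos
  exact absurd h3 (not_le.2 (mul_pos (Real.exp_pos _) hpos))

/-- Local existence for an autonomous Lipschitz vector field, uniformly in the initial point. -/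
theorem exists_forall_ball_exists_solution {F : Type*} [NormedAddCommGroup F] [NormedSpace ℝ F]
    [CompleteSpace F] {f : F → F} {y : F} {K : NNReal} {s : Set F} (hs : s ∈ 𝓝 y)
    (hf : LipschitzOnWith K f s) :
    ∃ r > 0, ∃ ε > 0, ∀ x ∈ Metric.closedBall y r, ∃ w : ℝ → F, w 0 = x ∧
      ∀ t ∈ Icc 0 ε, HasDerivWithinAt w (f (w t)) (Icc 0 ε) t := by
  obtain ⟨a, ha, has⟩ := Metric.nhds_basis_closedBall.mem_iff.1 hs
  set L := K * a + ‖f y‖ + 1 with hL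
  have hL0 : 0 < L := by positivity
  have hb : ∀ x ∈ Metric.closedBall y a, ‖f x‖ ≤ L := by
    intro x hx
    have h1 := hf.dist_le_mul _ (has hx) _ (mem_of_mem_nhds hs)
    have h2 : (K : ℝ) * dist x y ≤ K * a := by gcongr; exact hx
    rw [dist_eq_norm] at h1
    linarith [norm_le_norm_sub_add (f x) (f y)]
  -- A solution starting within `a / 2` of `y` with speed at most `L` stays in the ball of radius
  -- `a` for this long.
  set ε := a / 2 / L with hε
  have hε0 : 0 < ε := by positivity
  have hPL : IsPicardLindelof (fun _ => f) (tmin := 0) (tmax := ε) ⟨0, le_rfl, hε0.le⟩ y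
      ⟨a, ha.le⟩ ⟨a / 2, by positivity⟩ ⟨L, hL0.le⟩ K := by
    refine .of_time_independent hb (hf.mono has) ?_
    change L * max (ε - 0) (0 - 0) ≤ a - a / 2
    rw [sub_zero, sub_self, max_eq_left hε0.le, hε, mul_div_cancel₀ _ hL0.ne']
    linarith
  refine ⟨a / 2, by positivity, ε, hε0, fun x hx => ?_⟩
  obtain ⟨w, hw0, hw⟩ := hPL.exists_eq_forall_mem_Icc_hasDerivWithinAt hx
  exact ⟨w, hw0, hw⟩

/-! ### The convex program -/

section Program

variable {d q : ℕ} {V₀ : E d → ℝ} {V : Fin q → E d → ℝ} {α : ℝ} {β : E d → ℝ}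

theorem contDiff_gradient {f : E d → ℝ} (hf : ContDiff ℝ 2 f) : ContDiff ℝ 1 (gradient f) :=
  (InnerProductSpace.toDual ℝ (E d)).symm.contDiff.comp
    (hf.fderiv_right (m := 1) (by norm_num))

theorem gradient_constraint (j : Fin q) (ξ θ : E d) :
    gradient (fun x => constraint V α β j x θ) ξ = gradient (V j) θ + β θ • ξ := by
  refine HasGradientAt.gradient ?_
  rw [hasGradientAt_iff_hasFDerivAt]
  have h1 : HasFDerivAt (fun x : E d => inner ℝ (gradient (V j) θ) x)
      (innerSL ℝ (gradient (V j) θ)) ξ := (innerSL ℝ (gradient (V j) θ)).hasFDerivAt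
  have h2 : HasFDerivAt (fun x : E d => ‖x‖ ^ 2) (2 • innerSL ℝ ξ) ξ :=
    (hasStrictFDerivAt_norm_sq ξ).hasFDerivAt
  refine ((h1.const_add (α * V j θ)).add (h2.const_mul (β θ / 2))).congr_fderiv ?_
  ext h
  simp
  ring

theorem constraint_add (j : Fin q) (ξ h θ : E d) :
    constraint V α β j (ξ + h) θ = constraint V α β j ξ θ +
      inner ℝ (gradient (V j) θ + β θ • ξ) h + β θ / 2 * ‖h‖ ^ 2 := by
  simp only [constraint, inner_add_left, inner_add_right, real_inner_smul_left, norm_add_sq_real]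
  ring

theorem convexOn_constraint {θ : E d} (hβ : 0 ≤ β θ) (j : Fin q) :
    ConvexOn ℝ univ fun ξ => constraint V α β j ξ θ := by
  have h1 : ConvexOn ℝ univ fun ξ : E d => β θ / 2 * ‖ξ‖ ^ 2 :=
    (convexOn_univ_norm.pow (fun _ _ => norm_nonneg _) 2).smul (by positivity)
  have h2 : ConvexOn ℝ univ fun ξ : E d => inner ℝ (gradient (V j) θ) ξ :=
    (innerₛₗ ℝ (gradient (V j) θ)).convexOn convex_univ
  exact ((convexOn_const _ convex_univ).add h2).add h1

theorem continuous_constraint_left (j : Fin q) (θ : E d) :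
    Continuous fun ξ => constraint V α β j ξ θ := by
  unfold constraint
  fun_prop

theorem continuous_constraint {j : Fin q} (hV : ContDiff ℝ 2 (V j)) (hβ : Continuous β) :
    Continuous fun z : E d × E d => constraint V α β j z.1 z.2 := by
  have h1 := (contDiff_gradient hV).continuous
  have h2 := hV.continuous
  unfold constraint
  fun_prop

theorem isClosed_feasibleDirections (θ : E d) : IsClosed (feasibleDirections V α β θ) := by
  simp only [feasibleDirections, ofPred_forall]
  exact isClosed_iInter fun j => isClosed_le (continuous_constraint_left j θ) continuous_const

theorem convex_feasibleDirections {θ : E d} (hβ : 0 ≤ β θ) :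
    Convex ℝ (feasibleDirections V α β θ) := by
  simp only [feasibleDirections, ofPred_forall]
  refine convex_iInter fun j => ?_
  simpa using (convexOn_constraint (V := V) (α := α) hβ j).convex_le 0

theorem isArgmin_iff_norm_le {θ ξ : E d} : IsArgmin V₀ V α β θ ξ ↔
    ξ ∈ feasibleDirections V α β θ ∧ ∀ η ∈ feasibleDirections V α β θ,
      ‖ξ + gradient V₀ θ‖ ≤ ‖η + gradient V₀ θ‖ := by
  refine and_congr_right fun _ => forall₂_congr fun η _ => ?_
  rw [mul_le_mul_iff_right₀ (by norm_num), sq_le_sq₀ (norm_nonneg _) (norm_nonneg _)]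

theorem exists_isArgmin {θ : E d} (hne : (feasibleDirections V α β θ).Nonempty) :
    ∃ ξ, IsArgmin V₀ V α β θ ξ := by
  obtain ⟨ξ, hξ, hmin⟩ := (isClosed_feasibleDirections (V := V) (α := α) (β := β) θ
    ).exists_infDist_eq_dist hne (-gradient V₀ θ)
  refine ⟨ξ, isArgmin_iff_norm_le.2 ⟨hξ, fun η hη => ?_⟩⟩
  have h1 := Metric.infDist_le_dist_of_mem (x := -gradient V₀ θ) hη
  rw [hmin, dist_comm, dist_comm _ η, dist_eq_norm, dist_eq_norm] at h1
  simpa using h1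

/-- The variational inequality of a projection: by convexity the segment from `ξ` to `η` is
feasible. Adding two such inequalities gives uniqueness. -/
theorem IsArgmin.inner_le {θ ξ η : E d} (h : IsArgmin V₀ V α β θ ξ) (hβ : 0 ≤ β θ)
    (hη : η ∈ feasibleDirections V α β θ) : inner ℝ (ξ + gradient V₀ θ) (ξ - η) ≤ 0 := by
  refine inner_nonpos_of_forall_norm_le_norm_sub fun t ht => ?_
  have h1 := (isArgmin_iff_norm_le.1 h).2 _
    ((convex_feasibleDirections hβ).add_smul_sub_mem h.1 hη ⟨ht.1.le, ht.2⟩)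
  rwa [show ξ + gradient V₀ θ - t • (ξ - η) = ξ + t • (η - ξ) + gradient V₀ θ by module]

theorem IsArgmin.unique {θ ξ η : E d} (hξ : IsArgmin V₀ V α β θ ξ)
    (hη : IsArgmin V₀ V α β θ η) (hβ : 0 ≤ β θ) : ξ = η := by
  have h1 := hξ.inner_le hβ hη.1
  have h2 := hη.inner_le hβ hξ.1
  have h3 : inner ℝ (ξ - η) (ξ - η) = inner ℝ (ξ + gradient V₀ θ) (ξ - η) +
      inner ℝ (η + gradient V₀ θ) (η - ξ) := by
    simp only [inner_add_left, inner_sub_left, inner_sub_right]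
    ring
  rw [real_inner_self_eq_norm_sq] at h3
  have h4 : ‖ξ - η‖ ^ 2 ≤ 0 := by linarith
  rw [← sub_eq_zero]
  simpa using h4

theorem isArgmin_field {θ : E d} (hne : (feasibleDirections V α β θ).Nonempty) :
    IsArgmin V₀ V α β θ (field V₀ V α β θ) := by
  have h := exists_isArgmin (V₀ := V₀) hne
  rw [field, dif_pos h]
  exact h.choose_spec

theorem inner_gradient_field_le {θ : E d} (hne : (feasibleDirections V α β θ).Nonempty)
    (j : Fin q) : inner ℝ (gradient (V j) θ) (field V₀ V α β θ) ≤
      -α * V j θ - β θ / 2 * ‖field V₀ V α β θ‖ ^ 2 := by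
  have h := (isArgmin_field (V₀ := V₀) hne).1 j
  simp only [constraint] at h
  linarith

/-! ### Slater points and continuity of the field -/

/-- The parameters at which the program has a strictly feasible point. -/
def slaterSet (V : Fin q → E d → ℝ) (α : ℝ) (β : E d → ℝ) : Set (E d) :=
  {θ | ∃ ξ, ∀ j, constraint V α β j ξ θ < 0}

theorem eventually_constraint_neg (hV : ∀ j, ContDiff ℝ 2 (V j)) (hβ : Continuous β) {ξ θ : E d}
    (h : ∀ j, constraint V α β j ξ θ < 0) : ∀ᶠ η in 𝓝 θ, ∀ j, constraint V α β j ξ η < 0 := by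
  refine eventually_all.2 fun j => ?_
  have h1 : Continuous fun η => constraint V α β j ξ η :=
    (continuous_constraint (hV j) hβ).comp (continuous_const.prodMk continuous_id)
  exact h1.continuousAt.eventually_lt_const (h j)

theorem isOpen_slaterSet (hV : ∀ j, ContDiff ℝ 2 (V j)) (hβ : Continuous β) :
    IsOpen (slaterSet V α β) :=
  isOpen_iff_mem_nhds.2 fun _ ⟨ξ, hξ⟩ =>
    (eventually_constraint_neg hV hβ hξ).mono fun _ h => ⟨ξ, h⟩

theorem feasibleDirections_nonempty {θ : E d} (h : θ ∈ slaterSet V α β) :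
    (feasibleDirections V α β θ).Nonempty :=
  h.imp fun _ hξ j => (hξ j).le

/-- A small multiple `t • ξ` of the MFCQ direction is strictly feasible. Inactive constraints start
at `α V_j < 0`; for active ones the negative term linear in `t` dominates the quadratic one. -/
theorem mem_slaterSet {θ : E d} (hα : 0 < α) (hθ : θ ∈ feasibleSet V) (h : MFCQAt V θ) :
    θ ∈ slaterSet V α β := by
  obtain ⟨ξ, hξ⟩ := h
  have key : ∀ᶠ t in 𝓝[>] (0 : ℝ), ∀ j, constraint V α β j (t • ξ) θ < 0 := by
    refine eventually_all.2 fun j => ?_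
    rcases (hθ j).lt_or_eq with hj | hj
    · have h1 : Continuous fun t : ℝ => constraint V α β j (t • ξ) θ :=
        (continuous_constraint_left j θ).comp (by fun_prop)
      refine (h1.continuousAt.mono_left nhdsWithin_le_nhds).eventually_lt_const ?_
      simpa [constraint] using mul_neg_of_pos_of_neg hα hj
    · have h1 : Continuous fun t : ℝ => inner ℝ (gradient (V j) θ) ξ + β θ / 2 * ‖ξ‖ ^ 2 * t := by
        fun_prop
      have h2 := ((h1.tendsto' 0 (inner ℝ (gradient (V j) θ) ξ) (by simp)).mono_left
        (nhdsWithin_le_nhds (s := Ioi 0))).eventually_lt_const (hξ j hj)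
      filter_upwards [h2, self_mem_nhdsWithin] with t ht ht0
      have h3 : constraint V α β j (t • ξ) θ =
          t * (inner ℝ (gradient (V j) θ) ξ + β θ / 2 * ‖ξ‖ ^ 2 * t) := by
        simp only [constraint, hj, real_inner_smul_right, norm_smul, mul_pow, Real.norm_eq_abs,
          sq_abs]
        ring
      rw [h3]
      exact mul_neg_of_pos_of_neg ht0 ht
  obtain ⟨t, ht⟩ := key.exists
  exact ⟨t • ξ, ht⟩

/-- Comparison with a fixed Slater point bounds the minimizers near `θ`. Any cluster point is
feasible and optimal at `θ`, and uniqueness identifies it. -/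
theorem continuousAt_field (hV₀ : ContDiff ℝ 2 V₀) (hV : ∀ j, ContDiff ℝ 2 (V j))
    (hβ : Continuous β) (hβpos : ∀ θ, 0 < β θ) {θ : E d} (hθ : θ ∈ slaterSet V α β) :
    ContinuousAt (field V₀ V α β) θ := by
  obtain ⟨ζ, hζ⟩ := hθ
  have hG : Continuous (gradient V₀) := (contDiff_gradient hV₀).continuous
  have hle : ∀ ξ : E d, (∀ j, constraint V α β j ξ θ < 0) → ∀ᶠ η in 𝓝 θ,
      ‖field V₀ V α β η + gradient V₀ η‖ ≤ ‖ξ + gradient V₀ η‖ := by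
    intro ξ hξ
    filter_upwards [eventually_constraint_neg hV hβ hξ] with η hη
    exact (isArgmin_iff_norm_le.1 (isArgmin_field ⟨ξ, fun j => (hη j).le⟩)).2 ξ
      fun j => (hη j).le
  refine (isCompact_closedBall (0 : E d) (‖ζ‖ + 2 * (‖gradient V₀ θ‖ + 1))
    ).tendsto_nhds_of_unique_mapClusterPt ?_ ?_
  · filter_upwards [hle ζ hζ, hG.norm.continuousAt.eventually_lt_const
      (lt_add_one ‖gradient V₀ θ‖)] with η h1 h2
    rw [mem_closedBall_zero_iff]
    have h3 := norm_le_norm_add_norm_sub' (field V₀ V α β η + gradient V₀ η) (gradient V₀ η)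
    have h4 := norm_sub_le (field V₀ V α β η + gradient V₀ η) (gradient V₀ η)
    rw [add_sub_cancel_right] at h4
    linarith [norm_add_le ζ (gradient V₀ η)]
  · intro ξ _ hcl
    obtain ⟨U, hU, hUξ⟩ := mapClusterPt_iff_ultrafilter.1 hcl
    have hUθ : Tendsto (fun η : E d => η) U (𝓝 θ) := hU
    have hUG : Tendsto (gradient V₀) U (𝓝 (gradient V₀ θ)) := hG.continuousAt.tendsto.comp hUθ
    have hfeas : ξ ∈ feasibleDirections V α β θ := by
      intro j
      have h1 : Tendsto (fun η => constraint V α β j (field V₀ V α β η) η) U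
          (𝓝 (constraint V α β j ξ θ)) :=
        ((continuous_constraint (hV j) hβ).tendsto (ξ, θ)).comp (hUξ.prodMk_nhds hUθ)
      refine le_of_tendsto h1 (hU ?_)
      filter_upwards [eventually_constraint_neg hV hβ hζ] with η hη
      exact (isArgmin_field ⟨ζ, fun j => (hη j).le⟩).1 j
    have hmin : IsArgmin V₀ V α β θ ξ := by
      refine isArgmin_iff_norm_le.2 ⟨hfeas, fun ω hω => ?_⟩
      -- A competitor `ω` may become infeasible at nearby parameters, so it is first moved towards
      -- the Slater point `ζ`; strict feasibility persists, and `t → 0` recovers `ω`.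
      have h1 : ∀ t ∈ Ioc (0 : ℝ) 1,
          ‖ξ + gradient V₀ θ‖ ≤ ‖((1 - t) • ω + t • ζ) + gradient V₀ θ‖ := by
        intro t ht
        have h2 : ∀ j, constraint V α β j ((1 - t) • ω + t • ζ) θ < 0 := by
          intro j
          refine ((convexOn_constraint (V := V) (α := α) (hβpos θ).le j).2 (mem_univ ω)
            (mem_univ ζ) (sub_nonneg.2 ht.2) ht.1.le (by ring)).trans_lt ?_
          have h3 := mul_nonpos_of_nonneg_of_nonpos (sub_nonneg.2 ht.2) (hω j)
          have h4 := mul_neg_of_pos_of_neg ht.1 (hζ j)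
          simp only [smul_eq_mul]
          linarith
        exact le_of_tendsto_of_tendsto (hUξ.add hUG).norm (tendsto_const_nhds.add hUG).norm
          (hU (hle _ h2))
      have h2 : Tendsto (fun t : ℝ => ‖((1 - t) • ω + t • ζ) + gradient V₀ θ‖) (𝓝[>] 0)
          (𝓝 ‖((1 - (0 : ℝ)) • ω + (0 : ℝ) • ζ) + gradient V₀ θ‖) :=
        (Continuous.tendsto (by fun_prop) 0).mono_left nhdsWithin_le_nhds
      simp only [sub_zero, one_smul, zero_smul, add_zero] at h2
      exact ge_of_tendsto h2 (mem_of_superset (Ioc_mem_nhdsGT one_pos) h1)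
    exact hmin.unique (isArgmin_field ⟨ζ, fun j => (hζ j).le⟩) (hβpos θ).le

/-! ### Multipliers and local Lipschitz continuity of the field -/

/-- Karush-Kuhn-Tucker conditions with linearly independent active gradients. -/
theorem exists_multipliers (hβpos : ∀ θ, 0 < β θ) {θ ξ : E d} (hθ : θ ∈ slaterSet V α β)
    (hξ : IsArgmin V₀ V α β θ ξ) :
    ∃ l : Fin q → ℝ, (∀ j, 0 ≤ l j) ∧ (∀ j, l j ≠ 0 → constraint V α β j ξ θ = 0) ∧
      ξ + ∑ j, l j • (gradient (V j) θ + β θ • ξ) = -gradient V₀ θ ∧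
      LinearIndepOn ℝ (fun j => gradient (V j) θ + β θ • ξ) {j | l j ≠ 0} := by
  classical
  obtain ⟨ζ, hζ⟩ := hθ
  set a : Fin q → E d := fun j => gradient (V j) θ + β θ • ξ with ha
  have hslater : ∀ j, constraint V α β j ξ θ = 0 → inner ℝ (a j) (ζ - ξ) < 0 := by
    intro j hj
    have h1 := constraint_add (V := V) (α := α) (β := β) j ξ (ζ - ξ) θ
    rw [add_sub_cancel, hj] at h1
    have h2 : 0 ≤ β θ / 2 * ‖ζ - ξ‖ ^ 2 := by have := hβpos θ; positivity
    linarith [hζ j]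
  have hstrict : ∀ h, (∀ j, constraint V α β j ξ θ = 0 → inner ℝ (a j) h < 0) →
      inner ℝ (-(ξ + gradient V₀ θ)) h ≤ 0 := by
    intro h hh
    have key : ∀ᶠ t in 𝓝[>] (0 : ℝ), ∀ j, constraint V α β j (ξ + t • h) θ ≤ 0 := by
      refine eventually_all.2 fun j => ?_
      rcases (hξ.1 j).lt_or_eq with hj | hj
      · have h1 : Continuous fun t : ℝ => constraint V α β j (ξ + t • h) θ :=
          (continuous_constraint_left j θ).comp (by fun_prop)
        exact ((h1.tendsto' 0 _ (by simp)).mono_left nhdsWithin_le_nhds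
          |>.eventually_lt_const hj).mono fun _ => le_of_lt
      · have h1 : Continuous fun t : ℝ => inner ℝ (a j) h + β θ / 2 * ‖h‖ ^ 2 * t := by
          fun_prop
        have h2 := ((h1.tendsto' 0 (inner ℝ (a j) h) (by simp)).mono_left
          (nhdsWithin_le_nhds (s := Ioi 0))).eventually_lt_const (hh j hj)
        filter_upwards [h2, self_mem_nhdsWithin] with t ht ht0
        have h3 : constraint V α β j (ξ + t • h) θ =
            t * (inner ℝ (a j) h + β θ / 2 * ‖h‖ ^ 2 * t) := by
          rw [constraint_add, hj, real_inner_smul_right, norm_smul, mul_pow, Real.norm_eq_abs,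
            sq_abs]
          ring
        rw [h3]
        exact mul_nonpos_of_nonneg_of_nonpos (le_of_lt ht0) ht.le
    obtain ⟨t, ht, ht0⟩ := (key.and self_mem_nhdsWithin).exists
    have h1 := hξ.inner_le (hβpos θ).le ht
    rw [sub_add_cancel_left, inner_neg_right, real_inner_smul_right, ← mul_neg, ← inner_neg_left]
      at h1
    exact nonpos_of_mul_nonpos_right h1 ht0
  -- Adding `t • (ζ - ξ)` makes a weakly decreasing direction strictly decreasing; letting `t → 0`
  -- gives the hypothesis of Farkas' lemma.
  have hweak : ∀ h, (∀ j : {j // constraint V α β j ξ θ = 0}, inner ℝ (a j) h ≤ 0) →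
      inner ℝ (-(ξ + gradient V₀ θ)) h ≤ 0 := by
    intro h hh
    have h1 : ∀ t ∈ Ioi (0 : ℝ), inner ℝ (-(ξ + gradient V₀ θ)) (h + t • (ζ - ξ)) ≤ 0 := by
      intro t ht
      refine hstrict _ fun j hj => ?_
      rw [inner_add_right, real_inner_smul_right]
      linarith [hh ⟨j, hj⟩, mul_neg_of_pos_of_neg ht (hslater j hj)]
    have h2 : Tendsto (fun t : ℝ => inner ℝ (-(ξ + gradient V₀ θ)) (h + t • (ζ - ξ)))
        (𝓝[>] 0) (𝓝 (inner ℝ (-(ξ + gradient V₀ θ)) h)) :=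
      (Continuous.tendsto' (by fun_prop) 0 _ (by simp)).mono_left nhdsWithin_le_nhds
    exact le_of_tendsto h2 (mem_of_superset self_mem_nhdsWithin h1)
  obtain ⟨l₁, hl₁, hsum⟩ := exists_nonneg_combination_of_forall_inner_nonpos
    (fun j : {j // constraint V α β j ξ θ = 0} => a j) _ (ζ - ξ) (fun j => hslater j j.2) hweak
  set l₂ : Fin q → ℝ := fun j => if h : constraint V α β j ξ θ = 0 then l₁ ⟨j, h⟩ else 0 with hl₂
  have hl₂0 : ∀ j, 0 ≤ l₂ j := by
    intro j
    simp only [hl₂]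
    split_ifs with h
    exacts [hl₁ _, le_rfl]
  have hsum₂ : ∑ j, l₂ j • a j = -(ξ + gradient V₀ θ) := by
    rw [hsum]
    refine (Fintype.sum_of_injective (Subtype.val : {j // constraint V α β j ξ θ = 0} → Fin q)
      Subtype.val_injective _ _ (fun j hj => ?_) fun j => ?_).symm
    · have : constraint V α β j ξ θ ≠ 0 := by simpa using hj
      simp [hl₂, this]
    · simp [hl₂, j.2]
  obtain ⟨l, h1, h2, h3, h4⟩ := exists_nonneg_linearIndepOn_support a l₂ hl₂0
  refine ⟨l, h1, fun j hj => ?_, ?_, h4⟩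
  · by_contra h
    exact h2 j hj (by simp [hl₂, h])
  · rw [h3, hsum₂]
    abel

/-- Translates the rank of the image set in the constant-rank condition into independence of the
family; a repeated vector makes both sides fail. -/
theorem linearIndepOn_iff_finrank_image {ι F : Type*} [AddCommGroup F] [Module ℝ F] {a : ι → F}
    (s : Finset ι) :
    LinearIndepOn ℝ a (s : Set ι) ↔ Set.finrank ℝ (a '' (s : Set ι)) = s.card := by
  have h : LinearIndepOn ℝ a (s : Set ι) ↔ LinearIndependent ℝ fun i : s => a i := Iff.rfl
  rw [h, linearIndependent_iff_card_eq_finrank_span, Fintype.card_coe, eq_comm]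
  congr! 2
  ext x
  simp

/-- The field is Lipschitz near a parameter that satisfies Slater's condition and the constant-rank
condition. -/
theorem exists_lipschitzOnWith_field (hV₀ : ContDiff ℝ 2 V₀) (hV : ∀ j, ContDiff ℝ 2 (V j))
    (hβ : ContDiff ℝ 2 β) (hβpos : ∀ θ, 0 < β θ) {θ₀ : E d} (hθ₀ : θ₀ ∈ slaterSet V α β)
    (hCRC : ParametricCRCAt (constraint V α β) (field V₀ V α β θ₀) θ₀) :
    ∃ K : NNReal, ∃ s ∈ 𝓝 θ₀, LipschitzOnWith K (field V₀ V α β) s := by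
  classical
  set R := field V₀ V α β with hR
  have hRc : ∀ θ ∈ slaterSet V α β, ContinuousAt R θ := fun θ hθ =>
    continuousAt_field hV₀ hV hβ.continuous hβpos hθ
  have hpair : ContinuousAt (fun θ => (R θ, θ)) θ₀ := (hRc θ₀ hθ₀).prodMk continuousAt_id
  set a : Fin q → E d → E d := fun j θ => gradient (V j) θ + β θ • R θ with ha
  have hac : ∀ j, ContinuousAt (a j) θ₀ := fun j =>
    (contDiff_gradient (hV j)).continuous.continuousAt.add
      (hβ.continuous.continuousAt.smul (hRc θ₀ hθ₀))
  obtain ⟨N, hN, hrank⟩ := hCRC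
  -- All data of the program in one `C¹` map, so that one local Lipschitz constant serves them all.
  set Φ : E d → E d × ℝ × (Fin q → ℝ) × (Fin q → E d) := fun θ =>
    (-gradient V₀ θ, β θ, fun j => α * V j θ, fun j => gradient (V j) θ) with hΦ
  have hΦd : ContDiff ℝ 1 Φ := by
    refine (contDiff_gradient hV₀).neg.prodMk ((hβ.of_le (by norm_num)).prodMk
      ((contDiff_pi.2 fun j => ?_).prodMk (contDiff_pi.2 fun j => contDiff_gradient (hV j))))
    exact contDiff_const.mul ((hV j).of_le (by norm_num))
  obtain ⟨L, t, ht, hΦL⟩ := hΦd.contDiffAt (x := θ₀) |>.exists_lipschitzOnWith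
  set M := ‖Φ θ₀‖ + ‖R θ₀‖ + 1 with hM
  have hΦM : ∀ᶠ θ in 𝓝 θ₀, ‖Φ θ‖ < M :=
    hΦd.continuous.norm.continuousAt.eventually_lt_const (by
      rw [hM]; linarith [norm_nonneg (R θ₀)])
  have hRM : ∀ᶠ θ in 𝓝 θ₀, ‖R θ‖ < M :=
    (hRc θ₀ hθ₀).norm.eventually_lt_const (by rw [hM]; linarith [norm_nonneg (Φ θ₀)])
  have hact : ∀ᶠ θ in 𝓝 θ₀, ∀ j, constraint V α β j (R θ) θ = 0 →
      constraint V α β j (R θ₀) θ₀ = 0 := by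
    refine eventually_all.2 fun j => ?_
    by_cases hj : constraint V α β j (R θ₀) θ₀ = 0
    · exact .of_forall fun _ _ => hj
    · have h1 : ContinuousAt (fun θ => constraint V α β j (R θ) θ) θ₀ :=
        (continuous_constraint (hV j) hβ.continuous).continuousAt.comp hpair
      filter_upwards [h1.eventually_ne hj] with θ h2 h3
      exact absurd h3 h2
  -- The possible multiplier supports. Independence is required at `θ₀`, so that a single `σ I`
  -- works for all nearby parameters.
  let κ := {I : Finset (Fin q) // LinearIndepOn ℝ (fun j => a j θ₀) (I : Set (Fin q))}
  choose σ hσ hσa using fun I : κ => exists_forall_mul_sum_abs_le_norm_sum I.1 I.2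
  have hclose : ∀ᶠ θ in 𝓝 θ₀, ∀ I : κ, ∀ j ∈ I.1, ‖a j θ - a j θ₀‖ ≤ σ I := by
    refine eventually_all.2 fun I => (Finset.eventually_all _).2 fun j _ => ?_
    have h1 : ContinuousAt (fun θ => ‖a j θ - a j θ₀‖) θ₀ := ((hac j).sub continuousAt_const).norm
    exact (h1.eventually_lt_const (by simpa using hσ I)).mono fun _ => le_of_lt
  choose K hK0 hK using fun I : κ => IsKKT.exists_norm_sub_le (ι := Fin q) (F := E d) I.1 (hσ I)
    (show 0 ≤ M by positivity) L.coe_nonneg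
  have hslater : ∀ᶠ θ in 𝓝 θ₀, θ ∈ slaterSet V α β :=
    (isOpen_slaterSet hV hβ.continuous).mem_nhds hθ₀
  obtain ⟨ρ, hρ, hball⟩ := Metric.eventually_nhds_iff_ball.1 (hslater.and (hact.and (hclose.and
    (hΦM.and (hRM.and ((hpair.eventually hN).and ht))))))
  refine ⟨∑ I, (K I).toNNReal, Metric.ball θ₀ ρ, Metric.ball_mem_nhds _ hρ, ?_⟩
  refine lipschitzOnWith_of_finite_cover (convex_ball _ _)
    (fun θ hθ => (hRc θ (hball θ hθ).1).continuousWithinAt)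
    (fun I : κ => {θ | ∃ l, IsKKT I.1 (σ I) M (fun j => α * V j θ) (fun j => gradient (V j) θ)
      (β θ) (-gradient V₀ θ) (R θ) l}) ?_ ?_
  · intro θ hθ
    obtain ⟨h1, h2, h3, h4, h5, h6, -⟩ := hball θ hθ
    obtain ⟨l, hl, hlact, hstat, hind⟩ := exists_multipliers hβpos h1
      (isArgmin_field (V₀ := V₀) (feasibleDirections_nonempty h1))
    set I : Finset (Fin q) := Finset.univ.filter fun j => l j ≠ 0 with hI
    have hIcoe : (I : Set (Fin q)) = {j | l j ≠ 0} := by simp [hI]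
    rw [← hIcoe] at hind
    -- Here the constant-rank condition enters: the support consists of constraints active at `θ₀`,
    -- so the full rank found at `θ` is also the rank at `θ₀`.
    have hI0 : LinearIndepOn ℝ (fun j => a j θ₀) (I : Set (Fin q)) := by
      obtain ⟨r, hr⟩ := hrank I fun j hj => h2 j (hlact j (by simpa [hI] using hj))
      have e1 := hr _ (mem_of_mem_nhds hN)
      have e2 := hr _ h6
      simp only [gradient_constraint] at e1 e2
      rw [linearIndepOn_iff_finrank_image] at hind ⊢
      exact e1.trans (e2.symm.trans hind)
    have hΦ1 : ‖-gradient V₀ θ‖ ≤ M := (norm_fst_le (Φ θ)).trans h4.le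
    have hΦ2 : ‖β θ‖ ≤ M := ((norm_fst_le (Φ θ).2).trans (norm_snd_le (Φ θ))).trans h4.le
    refine mem_iUnion.2 ⟨⟨I, hI0⟩, l, ?_, ?_, hl, ?_, (hβpos θ).le, (le_abs_self _).trans hΦ2,
      hΦ1, h5.le⟩
    · intro j hj
      exact hlact j (by simpa [hI] using hj)
    · rw [← hstat]
      congr 1
      refine Finset.sum_subset (Finset.subset_univ _) fun j _ hj => ?_
      have : l j = 0 := by simpa [hI] using hj
      simp [this]
    · exact hσa ⟨I, hI0⟩ (fun j => a j θ) (h3 ⟨I, hI0⟩)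
  · intro I
    refine LipschitzOnWith.weaken (K := (K I).toNNReal) ?_
      (Finset.single_le_sum (f := fun I => (K I).toNNReal) (fun _ _ => zero_le)
        (Finset.mem_univ I))
    refine LipschitzOnWith.of_dist_le_mul ?_
    rintro θ' ⟨⟨l', hl'⟩, hθ'⟩ θ ⟨⟨l, hl⟩, hθ⟩
    obtain ⟨-, -, -, -, -, -, h1⟩ := hball θ hθ
    obtain ⟨-, -, -, -, -, -, h2⟩ := hball θ' hθ'
    have hd := hΦL.dist_le_mul _ h2 _ h1
    rw [dist_eq_norm (Φ θ')] at hd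
    rw [Real.coe_toNNReal _ (hK0 I), dist_eq_norm]
    have n1 := (norm_fst_le (Φ θ' - Φ θ)).trans hd
    have n2 := (norm_snd_le (Φ θ' - Φ θ)).trans hd
    have n3 := (norm_snd_le (Φ θ' - Φ θ).2).trans n2
    have n4 := (norm_fst_le (Φ θ' - Φ θ).2).trans n2
    have n5 := (norm_fst_le (Φ θ' - Φ θ).2.2).trans n3
    have n6 := (norm_snd_le (Φ θ' - Φ θ).2.2).trans n3
    exact hK I _ _ _ _ _ _ _ _ _ _ _ _ _ hl hl' dist_nonneg
      (fun j => (norm_le_pi_norm (Φ θ' - Φ θ).2.2.1 j).trans n5)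
      (fun j => (norm_le_pi_norm (Φ θ' - Φ θ).2.2.2 j).trans n6) n4 n1

end Program

/-! ### Trajectories -/

section Trajectories

variable {d : ℕ} {F : E d → E d} {J J' : Set ℝ} {x : E d} {z w : ℝ → E d}

theorem isTimeInterval_Icc {t : ℝ} (ht : 0 ≤ t) : IsTimeInterval (Icc 0 t) :=
  ⟨ordConnected_Icc, isLeast_Icc ht⟩

theorem IsTimeInterval.Icc_subset (hJ : IsTimeInterval J) {t : ℝ} (ht : t ∈ J) : Icc 0 t ⊆ J :=
  hJ.1.out hJ.2.1 ht

theorem IsTimeInterval.nonneg (hJ : IsTimeInterval J) {t : ℝ} (ht : t ∈ J) : 0 ≤ t :=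
  hJ.2.2 ht

theorem IsTrajectory.mono (h : IsTrajectory F J x z) (hJ' : IsTimeInterval J') (hsub : J' ⊆ J) :
    IsTrajectory F J' x z :=
  ⟨hJ', h.2.1, fun t ht => (h.2.2 t (hsub ht)).mono hsub⟩

theorem IsTrajectory.restrict (h : IsTrajectory F J x z) {t : ℝ} (ht : t ∈ J) :
    IsTrajectory F (Icc 0 t) x z :=
  h.mono (isTimeInterval_Icc (h.1.nonneg ht)) (h.1.Icc_subset ht)

theorem IsTrajectory.continuousOn (h : IsTrajectory F J x z) : ContinuousOn z J :=
  fun t ht => (h.2.2 t ht).continuousWithinAt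

theorem IsTrajectory.hasDerivWithinAt_Ici {t : ℝ} (h : IsTrajectory F (Icc 0 t) x z) {s : ℝ}
    (hs : s ∈ Ico 0 t) : HasDerivWithinAt z (F (z s)) (Ici s) s := by
  refine (h.2.2 s ⟨hs.1, hs.2.le⟩).mono_of_mem_nhdsWithin ?_
  filter_upwards [Icc_mem_nhdsGE hs.2] with r hr using ⟨hs.1.trans hr.1, hr.2⟩

theorem IsTrajectory.exists_forall_mem {t : ℝ} (h : IsTrajectory F (Icc 0 t) x z) {s : ℝ}
    (hs : s ∈ Ico 0 t) {U : Set (E d)} (hU : U ∈ 𝓝 (z s)) :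
    ∃ u > s, ∀ r ∈ Icc s u, z r ∈ U := by
  have h1 := (h.hasDerivWithinAt_Ici hs).continuousWithinAt.eventually_mem hU
  obtain ⟨u, hu, hsub⟩ := mem_nhdsGE_iff_exists_Icc_subset.1 h1
  exact ⟨u, hu, hsub⟩

/-- Uniqueness of trajectories that meet only points near which the field is Lipschitz. -/
theorem IsTrajectory.eqOn {t : ℝ} (hz : IsTrajectory F (Icc 0 t) x z)
    (hw : IsTrajectory F (Icc 0 t) x w)
    (hLip : ∀ s ∈ Icc 0 t, ∃ K : NNReal, ∃ U ∈ 𝓝 (z s), LipschitzOnWith K F U) :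
    EqOn z w (Icc 0 t) := by
  -- Continuous induction on the closed coincidence set: at a common point both curves stay briefly
  -- in one Lipschitz neighbourhood.
  refine IsClosed.Icc_subset_of_forall_exists_gt (s := {s | z s = w s}) ?_
    (hz.2.1.trans hw.2.1.symm) ?_
  · rw [inter_comm]
    convert (hz.continuousOn.sub hw.continuousOn).preimage_isClosed_of_isClosed isClosed_Icc
      (isClosed_singleton (x := (0 : E d))) using 2
    ext s
    simp [sub_eq_zero]
  · rintro s ⟨hs, hst⟩ y hy
    obtain ⟨K, U, hU, hKU⟩ := hLip s ⟨hst.1, hst.2.le⟩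
    obtain ⟨u₁, hu₁, h1⟩ := hz.exists_forall_mem hst hU
    obtain ⟨u₂, hu₂, h2⟩ := hw.exists_forall_mem hst (hs ▸ hU)
    set u := min (min u₁ u₂) (min y t) with hu
    have hsu : s < u := lt_min (lt_min hu₁ hu₂) (lt_min hy hst.2)
    have hut : u ≤ t := (min_le_right _ _).trans (min_le_right _ _)
    have hsub : Icc s u ⊆ Icc 0 t := Icc_subset_Icc hst.1 hut
    have hIco : ∀ r ∈ Ico s u, r ∈ Ico 0 t := fun r hr =>
      ⟨hst.1.trans hr.1, hr.2.trans_le hut⟩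
    have key := ODE_solution_unique_of_mem_Icc_right (v := fun _ => F) (s := fun _ => U)
      (fun _ _ => hKU) (hz.continuousOn.mono hsub)
      (fun r hr => hz.hasDerivWithinAt_Ici (hIco r hr))
      (fun r hr => h1 r ⟨hr.1, hr.2.le.trans ((min_le_left _ _).trans (min_le_left _ _))⟩)
      (hw.continuousOn.mono hsub) (fun r hr => hw.hasDerivWithinAt_Ici (hIco r hr))
      (fun r hr => h2 r ⟨hr.1, hr.2.le.trans ((min_le_left _ _).trans (min_le_right _ _))⟩) hs
    exact ⟨u, key ⟨hsu.le, le_rfl⟩, hsu, (min_le_right _ _).trans (min_le_left _ _)⟩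

/-- A trajectory can be prolonged by a solution that starts at its end point. -/
theorem IsTrajectory.exists_extension {t ε : ℝ} (hε : 0 ≤ ε) (ht : 0 ≤ t)
    (hz : IsTrajectory F (Icc 0 t) x z) (hw0 : w 0 = z t)
    (hw : ∀ s ∈ Icc 0 ε, HasDerivWithinAt w (F (w s)) (Icc 0 ε) s) :
    ∃ v, IsTrajectory F (Icc 0 (t + ε)) x v := by
  set v : ℝ → E d := fun r => if r ≤ t then z r else w (r - t) with hv
  have hv1 : EqOn v z (Icc 0 t) := fun r hr => by simp [hv, hr.2]
  have hv2 : EqOn v (fun r => w (r - t)) (Icc t (t + ε)) := by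
    intro r hr
    rcases hr.1.eq_or_lt with h | h
    · simp [hv, ← h, hw0]
    · simp [hv, not_le.2 h]
  have d1 : ∀ r, HasDerivWithinAt v (F (v r)) (Icc 0 t) r := by
    intro r
    by_cases hr : r ∈ Icc 0 t
    · rw [hv1 hr]
      exact (hz.2.2 r hr).congr hv1 (hv1 hr)
    -- Off the closed piece the derivative statement is vacuous, so the two pieces can be joined at
    -- every `r`, including the junction.
    · exact HasFDerivWithinAt.of_notMem_closure (by rwa [closure_Icc])
  have d2 : ∀ r, HasDerivWithinAt v (F (v r)) (Icc t (t + ε)) r := by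
    intro r
    by_cases hr : r ∈ Icc t (t + ε)
    · rw [hv2 hr]
      have h1 : r - t ∈ Icc 0 ε := ⟨by linarith [hr.1], by linarith [hr.2]⟩
      have h2 := HasDerivWithinAt.scomp r (hw _ h1) ((hasDerivAt_id r).sub_const t).hasDerivWithinAt
        (s := Icc t (t + ε)) fun s hs => ⟨by simpa using hs.1, by simpa [add_comm] using hs.2⟩
      rw [one_smul] at h2
      exact h2.congr hv2 (hv2 hr)
    · exact HasFDerivWithinAt.of_notMem_closure (by rwa [closure_Icc])
  refine ⟨v, isTimeInterval_Icc (by positivity), ?_, fun r _ => ?_⟩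
  · rw [hv1 (left_mem_Icc.2 ht), hz.2.1]
  · rw [← Icc_union_Icc_eq_Icc ht (le_add_of_nonneg_right hε)]
    exact (d1 r).union (d2 r)

/-- Maximal trajectories in a closed set that every trajectory starting in it does not leave, for
a field that is Lipschitz near each point of the set. -/
theorem exists_isMaximalTrajectory {C : Set (E d)} (hC : IsClosed C)
    (hLip : ∀ y ∈ C, ∃ K : NNReal, ∃ U ∈ 𝓝 y, LipschitzOnWith K F U)
    (hInv : ∀ (x : E d) (J : Set ℝ) (z : ℝ → E d), x ∈ C → IsTrajectory F J x z →
      ∀ t ∈ J, z t ∈ C) (hx : x ∈ C) :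
    ∃ (J : Set ℝ) (z : ℝ → E d), IsMaximalTrajectory F J x z ∧
      (J = Ici 0 ∨ ∃ T : ℝ, 0 < T ∧ J = Ico 0 T ∧ Tendsto (fun t => ‖z t‖) (𝓝[<] T) atTop) := by
  classical
  set J : Set ℝ := {t | 0 ≤ t ∧ ∃ w, IsTrajectory F (Icc 0 t) x w} with hJ
  have huniq : ∀ {t : ℝ} {w₁ w₂ : ℝ → E d}, IsTrajectory F (Icc 0 t) x w₁ →
      IsTrajectory F (Icc 0 t) x w₂ → EqOn w₁ w₂ (Icc 0 t) := fun h₁ h₂ =>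
    h₁.eqOn h₂ fun s hs => hLip _ (hInv x _ _ hx h₁ s hs)
  choose! W hW using fun (t : ℝ) (ht : t ∈ J) => ht.2
  -- Diagonal gluing: `z t` is the endpoint of a chosen trajectory on `[0, t]`; uniqueness makes the
  -- choices compatible.
  set z : ℝ → E d := fun t => W t t with hz
  have hagree : ∀ (J' : Set ℝ) (w : ℝ → E d), IsTrajectory F J' x w → J' ⊆ J ∧ EqOn z w J' := by
    intro J' w hw
    have hsub : J' ⊆ J := fun t ht => ⟨hw.1.nonneg ht, w, hw.restrict ht⟩
    exact ⟨hsub, fun t ht => huniq (hW t (hsub ht)) (hw.restrict ht)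
      (right_mem_Icc.2 (hw.1.nonneg ht))⟩
  have hext : ∀ y ∈ C, ∃ r > 0, ∃ ε > 0, ∀ t ∈ J, z t ∈ Metric.closedBall y r → t + ε ∈ J := by
    intro y hy
    obtain ⟨K, U, hU, hKU⟩ := hLip y hy
    obtain ⟨r, hr, ε, hε, hsol⟩ := exists_forall_ball_exists_solution hU hKU
    refine ⟨r, hr, ε, hε, fun t ht hzt => ?_⟩
    obtain ⟨w, hw0, hw⟩ := hsol _ hzt
    exact ⟨add_nonneg ht.1 hε.le, (hW t ht).exists_extension hε.le ht.1 hw0 hw⟩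
  have hzC : ∀ t ∈ J, z t ∈ C := fun t ht => hInv x _ _ hx (hW t ht) t (right_mem_Icc.2 ht.1)
  have hgt : ∀ t ∈ J, ∃ t' ∈ J, t < t' := by
    intro t ht
    obtain ⟨r, hr, ε, hε, h⟩ := hext _ (hzC t ht)
    exact ⟨t + ε, h t ht (Metric.mem_closedBall_self hr.le), lt_add_of_pos_right _ hε⟩
  have hdown : ∀ t ∈ J, Icc 0 t ⊆ J := fun t ht => (hagree _ _ (hW t ht)).1
  have h0 : (0 : ℝ) ∈ J := by
    refine ⟨le_rfl, fun _ => x, isTimeInterval_Icc le_rfl, rfl, fun t _ => ?_⟩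
    rw [Icc_self]
    exact HasFDerivWithinAt.of_subsingleton subsingleton_singleton
  have hJint : IsTimeInterval J :=
    ⟨⟨fun s hs t ht r hr => hdown t ht ⟨hs.1.trans hr.1, hr.2⟩⟩, h0, fun t ht => ht.1⟩
  have htraj : IsTrajectory F J x z := by
    refine ⟨hJint, (hW 0 h0).2.1, fun t ht => ?_⟩
    obtain ⟨t', ht', htt'⟩ := hgt t ht
    have heq := (hagree _ _ (hW t' ht')).2
    have hmem : t ∈ Icc 0 t' := ⟨ht.1, htt'.le⟩
    have h1 : HasDerivWithinAt z (F (z t)) (Icc 0 t') t := by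
      rw [heq hmem]
      exact ((hW t' ht').2.2 t hmem).congr heq (heq hmem)
    refine h1.mono_of_mem_nhdsWithin ?_
    filter_upwards [self_mem_nhdsWithin, mem_nhdsWithin_of_mem_nhds (Iio_mem_nhds htt')]
      with r hr hr' using ⟨hr.1, le_of_lt hr'⟩
  refine ⟨J, z, ⟨htraj, fun J' w hw => (hagree J' w hw).imp_right fun h => h.symm⟩, ?_⟩
  by_cases hbdd : BddAbove J
  · right
    have hlub := isLUB_csSup ⟨0, h0⟩ hbdd
    set T := sSup J with hT
    have hlt : ∀ t ∈ J, t < T := by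
      intro t ht
      obtain ⟨t', ht', htt'⟩ := hgt t ht
      exact htt'.trans_le (hlub.1 ht')
    have hJT : J = Ico 0 T := by
      refine Subset.antisymm (fun t ht => ⟨ht.1, hlt t ht⟩) fun t ht => ?_
      obtain ⟨s, hs, hts⟩ := (lt_isLUB_iff hlub).1 ht.2
      exact hdown s hs ⟨ht.1, hts.le⟩
    have hT0 : 0 < T := hlt 0 h0
    refine ⟨T, hT0, hJT, ?_⟩
    by_contra hnot
    -- If the norm does not tend to infinity, `z` visits a fixed ball at times tending to `T`. A
    -- cluster point lies in the closed set `C`, and the step `ε` available throughout a ball around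
    -- it leads past `T`.
    obtain ⟨b, hb⟩ := not_forall.1 (mt tendsto_atTop.2 hnot)
    have hfr : ∃ᶠ t in 𝓝[<] T, ‖z t‖ ≤ b :=
      (not_eventually.1 hb).mono fun t ht => (not_le.1 ht).le
    set l := 𝓝[<] T ⊓ 𝓟 {t | ‖z t‖ ≤ b} with hl
    have : l.NeBot := frequently_iff_neBot.1 hfr
    have hIco : ∀ᶠ t in l, t ∈ J := by
      rw [hJT]
      exact (inf_le_left : l ≤ _) (Ico_mem_nhdsLT hT0)
    obtain ⟨y, -, hy⟩ := (isCompact_closedBall (0 : E d) b).exists_mapClusterPt (u := z) (f := l) (by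
      refine tendsto_principal.2 (mem_inf_of_right ?_)
      intro t ht
      simpa using ht)
    have hyC : y ∈ C := hC.mem_of_mapClusterPt hy (hIco.mono hzC)
    obtain ⟨r, hr, ε, hε, hstep⟩ := hext y hyC
    have hnear : ∀ᶠ t in l, T - ε < t :=
      (inf_le_left : l ≤ _) (mem_nhdsWithin_of_mem_nhds (Ioi_mem_nhds (sub_lt_self T hε)))
    obtain ⟨t, ht, htJ, htε⟩ := ((hy.frequently (Metric.closedBall_mem_nhds y hr)).and_eventually
      (hIco.and hnear)).exists
    linarith [hlt _ (hstep t htJ ht)]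
  · left
    refine Subset.antisymm (fun t ht => ht.1) fun t ht => ?_
    obtain ⟨s, hs, hts⟩ := not_bddAbove_iff.1 hbdd t
    exact hdown s hs ⟨ht, hts.le⟩

end Trajectories

/-! ### Safety of the robust safe gradient flow -/

section Safety

variable {d q : ℕ} {V₀ : E d → ℝ} {V : Fin q → E d → ℝ} {α : ℝ} {β : E d → ℝ}

theorem isClosed_feasibleSet (hV : ∀ j, Continuous (V j)) : IsClosed (feasibleSet V) := by
  simp only [feasibleSet, ofPred_forall]
  exact isClosed_iInter fun j => isClosed_le (hV j) continuous_const

/-- Continuous induction: from a feasible point the trajectory stays for a while in the open Slater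
set, where `V_j' ≤ -α V_j` holds whether or not the point is feasible, and so no `V_j` becomes
positive. Uniqueness of trajectories plays no role. -/
theorem IsTrajectory.mem_feasibleSet (hV : ∀ j, ContDiff ℝ 2 (V j)) (hβ : Continuous β)
    (hβpos : ∀ θ, 0 < β θ) (hsub : feasibleSet V ⊆ slaterSet V α β) {x : E d} {J : Set ℝ}
    {z : ℝ → E d} (hx : x ∈ feasibleSet V) (hz : IsTrajectory (field V₀ V α β) J x z) :
    ∀ t ∈ J, z t ∈ feasibleSet V := by
  intro t ht
  have ht0 : 0 ≤ t := hz.1.nonneg ht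
  replace hz := hz.restrict ht
  suffices Icc 0 t ⊆ {s | z s ∈ feasibleSet V} from this (right_mem_Icc.2 ht0)
  refine IsClosed.Icc_subset_of_forall_exists_gt ?_ (by simpa [hz.2.1] using hx) ?_
  · rw [inter_comm]
    exact hz.continuousOn.preimage_isClosed_of_isClosed isClosed_Icc
      (isClosed_feasibleSet fun j => (hV j).continuous)
  · rintro s ⟨hs, hst⟩ y hy
    obtain ⟨u₁, hu₁, h1⟩ := hz.exists_forall_mem hst
      ((isOpen_slaterSet (α := α) hV hβ).mem_nhds (hsub hs))
    set u := min u₁ (min y t) with hu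
    have hsu : s < u := lt_min hu₁ (lt_min hy hst.2)
    have hut : u ≤ t := (min_le_right _ _).trans (min_le_right _ _)
    refine ⟨u, fun j => ?_, hsu, (min_le_right _ _).trans (min_le_left _ _)⟩
    refine nonpos_of_deriv_le_neg_mul (u := fun r => V j (z r)) (c := α)
      (u' := fun r => inner ℝ (gradient (V j) (z r)) (field V₀ V α β (z r))) (a := s) (b := u)
      ?_ ?_ ?_ (hs j) u ⟨hsu.le, le_rfl⟩
    · exact (hV j).continuous.comp_continuousOn
        (hz.continuousOn.mono (Icc_subset_Icc hst.1 hut))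
    · intro r hr
      have hr0 : r ∈ Ioo 0 t := ⟨hst.1.trans_lt hr.1, hr.2.trans_le hut⟩
      have h2 : HasDerivAt z (field V₀ V α β (z r)) r :=
        (hz.2.2 r ⟨hr0.1.le, hr0.2.le⟩).hasDerivAt (Icc_mem_nhds hr0.1 hr0.2)
      have h3 := (((hV j).differentiable (by norm_num)) (z r)).hasGradientAt.hasFDerivAt
      exact h3.comp_hasDerivAt r h2
    · intro r hr
      have h2 : z r ∈ slaterSet V α β := h1 r ⟨hr.1.le, hr.2.le.trans (min_le_left _ _)⟩
      have h3 := inner_gradient_field_le (V₀ := V₀) (feasibleDirections_nonempty h2) j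
      have h4 : 0 ≤ β (z r) / 2 * ‖field V₀ V α β (z r)‖ ^ 2 := by
        have := hβpos (z r)
        positivity
      linarith

end Safety

end RSGF

/-! ### Assembly of existence, safety and forward invariance -/

theorem mainTheorem5 {d q : ℕ} (V₀ : RSGF.E d → ℝ) (V : Fin q → RSGF.E d → ℝ)
    (α : ℝ) (β : RSGF.E d → ℝ) (hα : 0 < α) (hβpos : ∀ θ, 0 < β θ)
    -- regularity
    (hV₀ : ContDiff ℝ 2 V₀) (hV : ∀ j, ContDiff ℝ 2 (V j)) (hβ : ContDiff ℝ 2 β)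
    -- constraint qualifications in the feasible set
    (hMFCQ : ∀ θ ∈ RSGF.feasibleSet V, RSGF.MFCQAt V θ)
    (hCRC : ∀ θ ∈ RSGF.feasibleSet V,
      RSGF.ParametricCRCAt (RSGF.constraint V α β) (RSGF.field V₀ V α β θ) θ) :
    -- the vector field is well defined wherever its program is feasible, in particular on the
    -- feasible set, and satisfies the key inequality there
    (∀ θ ∈ RSGF.feasibleSet V, (RSGF.feasibleDirections V α β θ).Nonempty) ∧
    (∀ θ, (RSGF.feasibleDirections V α β θ).Nonempty →
      (∀ ξ, RSGF.IsArgmin V₀ V α β θ ξ ↔ ξ = RSGF.field V₀ V α β θ) ∧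
      ∀ j, inner ℝ (gradient (V j) θ) (RSGF.field V₀ V α β θ) ≤
        -α * V j θ - β θ / 2 * ‖RSGF.field V₀ V α β θ‖ ^ 2) ∧
    -- safety: the maximal trajectory from a feasible point exists, is unique and stays feasible;
    -- it is forward complete unless its norm tends to infinity in finite time
    (∀ x ∈ RSGF.feasibleSet V, ∃ (J : Set ℝ) (z : ℝ → RSGF.E d),
      RSGF.IsMaximalTrajectory (RSGF.field V₀ V α β) J x z ∧
      (∀ t ∈ J, z t ∈ RSGF.feasibleSet V) ∧
      (J = Ici 0 ∨
        ∃ T : ℝ, 0 < T ∧ J = Ico 0 T ∧ Tendsto (fun t => ‖z t‖) (𝓝[<] T) atTop)) ∧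
    -- without finite-time escape to infinity, the feasible set is forward invariant
    ((∀ x ∈ RSGF.feasibleSet V, ∀ (T : ℝ) (z : ℝ → RSGF.E d), 0 < T →
        RSGF.IsTrajectory (RSGF.field V₀ V α β) (Ico 0 T) x z →
        Bornology.IsBounded (z '' Ico 0 T)) →
      RSGF.ForwardInvariant (RSGF.field V₀ V α β) (RSGF.feasibleSet V)) ∧
    -- in particular when the feasible set is bounded
    (Bornology.IsBounded (RSGF.feasibleSet V) →
      RSGF.ForwardInvariant (RSGF.field V₀ V α β) (RSGF.feasibleSet V)) := by
  have hslater : RSGF.feasibleSet V ⊆ RSGF.slaterSet V α β := fun θ hθ =>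
    RSGF.mem_slaterSet hα hθ (hMFCQ θ hθ)
  have hsafe : ∀ x ∈ RSGF.feasibleSet V, ∃ (J : Set ℝ) (z : ℝ → RSGF.E d),
      RSGF.IsMaximalTrajectory (RSGF.field V₀ V α β) J x z ∧
      (∀ t ∈ J, z t ∈ RSGF.feasibleSet V) ∧
      (J = Ici 0 ∨
        ∃ T : ℝ, 0 < T ∧ J = Ico 0 T ∧ Tendsto (fun t => ‖z t‖) (𝓝[<] T) atTop) := by
    intro x hx
    obtain ⟨J, z, hz, hJ⟩ := RSGF.exists_isMaximalTrajectory
      (RSGF.isClosed_feasibleSet fun j => (hV j).continuous)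
      (fun y hy => RSGF.exists_lipschitzOnWith_field hV₀ hV hβ hβpos (hslater hy) (hCRC y hy))
      (fun _ _ _ hx hz => hz.mem_feasibleSet hV hβ.continuous hβpos hslater hx) hx
    exact ⟨J, z, hz, hz.1.mem_feasibleSet hV hβ.continuous hβpos hslater hx, hJ⟩
  have hcomplete : (∀ x ∈ RSGF.feasibleSet V, ∀ (T : ℝ) (z : ℝ → RSGF.E d), 0 < T →
      RSGF.IsTrajectory (RSGF.field V₀ V α β) (Ico 0 T) x z →
      Bornology.IsBounded (z '' Ico 0 T)) →
      RSGF.ForwardInvariant (RSGF.field V₀ V α β) (RSGF.feasibleSet V) := by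
    intro hbdd x hx
    obtain ⟨J, z, hz, hmem, rfl | ⟨T, hT, rfl, hlim⟩⟩ := hsafe x hx
    · exact ⟨z, hz, hmem⟩
    · obtain ⟨b, hb⟩ := (hbdd x hx T z hT hz.1).exists_norm_le
      obtain ⟨t, ht, htT⟩ := ((hlim.eventually_gt_atTop b).and (Ico_mem_nhdsLT hT)).exists
      exact absurd (hb _ (mem_image_of_mem z htT)) (not_le.2 ht)
  refine ⟨fun θ hθ => RSGF.feasibleDirections_nonempty (hslater hθ), fun θ hθ => ⟨fun ξ => ?_,
    RSGF.inner_gradient_field_le hθ⟩, hsafe, hcomplete, fun hbdd => hcomplete ?_⟩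
  · have h := RSGF.isArgmin_field (V₀ := V₀) hθ
    exact ⟨fun hξ => hξ.unique h (hβpos θ).le, fun hξ => hξ ▸ h⟩
  · intro x hx T z _ hz
    refine hbdd.subset (image_subset_iff.2 fun t ht => ?_)
    exact hz.mem_feasibleSet hV hβ.continuous hβpos hslater hx t ht
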